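/- Let $K$ be an algebraically closed field and let $V$ be a finite-dimensional $K$-vector space. Let $\mathrm{Ass}_V(K)$ be the set of (not necessarily unital) associative $K$-algebra structures on $V$, i.e. of bilinear maps $\varphi : V\times V\to V$ with $\varphi(\varphi(x,y),z)=\varphi(x,\varphi(y,z))$ for all $x,y,z\in V$, with the topology induced by the Zariski topology of the vector space of all bilinear maps $V\times V\to V$. The group $\mathrm{GL}(V)$ acts on it by $(g\cdot\varphi)(x,y)=g\,\varphi(g^{-1}x,g^{-1}y)$; write $\mathcal O_A$ for the orbit of $A$ and $\overline{\mathcal O_A}$ for its Zariski closure. An algebra $B\in\mathrm{Ass}_V(K)$ is called a degeneration of $A\in\mathrm{Ass}_V(K)$ if $\mathcal O_B\subseteq\overline{\mathcal O_A}$. A (Gerstenhaber) formal deformation of $B$ is a pair $(\mathfrak X,\Phi)$, where $\mathfrak X$ is a (not necessarily unital) associative $K[[t]]$-algebra which, as a $K[[t]]$-module, is torsion-free and complete (that is, separated and complete in the $t$-adic topology), and $\Phi:\mathfrak X\otimes_{K[[t]]}K\to B$ is an isomorphism of $K$-algebras, where $K[[t]]$ acts on $K$ through $f\mapsto f(0)$.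 **Theorem.** Let $A,B\in\mathrm{Ass}_V(K)$. Then $B$ is a degeneration of $A$ if and only if there exists a formal deformation $(\mathfrak X,\Phi)$ of $B$ such that $\mathfrak X\otimes_{K[[t]]}K((t))$ and $A\otimes_K K((t))$ are isomorphic as $K((t))$-algebras. -/

import Mathlib

open scoped TensorProduct PowerSeries LaurentSeries

universe u v w

/-- A (not necessarily unital) associative `R`-algebra structure on the `R`-module `M`: an
`R`-bilinear multiplication satisfying the associativity law. For `R = K` a field and `M = V`
a finite dimensional space this is a point of the variety of associative algebra structures
on `V`. -/
@[ext]
structure AssocStructure (R : Type u) (M : Type v) [CommRing R] [AddCommGroup M]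
    [Module R M] where
  mul : M →ₗ[R] M →ₗ[R] M
  assoc : ∀ x y z, mul (mul x y) z = mul x (mul y z)

namespace AssocStructure

section General

variable {R : Type*} {M N : Type*} [CommRing R] [AddCommGroup M] [Module R M]
  [AddCommGroup N] [Module R N]

/-- Two algebra structures are isomorphic if there is a multiplicative linear bijection. -/
def IsIsomorphic (φ : AssocStructure R M) (ψ : AssocStructure R N) : Prop :=
  ∃ e : M ≃ₗ[R] N, ∀ x y, e (φ.mul x y) = ψ.mul (e x) (e y)

/-- Extension of scalars: the algebra structure on `S ⊗[R] M` determined by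
`(a ⊗ x) (b ⊗ y) = a b ⊗ x y`. -/
def baseChange (S : Type*) [CommRing S] [Algebra R S] (φ : AssocStructure R M) :
    AssocStructure S (S ⊗[R] M) where
  mul := LinearMap.BilinMap.baseChange S φ.mul
  assoc x y z := by
    induction x using TensorProduct.induction_on with
    | zero => simp
    | add x₁ x₂ h₁ h₂ => simp only [map_add, LinearMap.add_apply, h₁, h₂]
    | tmul a x =>
      induction y using TensorProduct.induction_on with
      | zero => simp
      | add y₁ y₂ h₁ h₂ => simp only [map_add, LinearMap.add_apply, h₁, h₂]
      | tmul b y =>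
        induction z using TensorProduct.induction_on with
        | zero => simp
        | add z₁ z₂ h₁ h₂ => simp only [map_add, h₁, h₂]
        | tmul c z => simp [mul_assoc, φ.assoc]

/-- The action of `GL(M)` by transport of structure,
`(g • φ)(x, y) = g (φ (g⁻¹ x, g⁻¹ y))`. -/
instance : MulAction (M ≃ₗ[R] M) (AssocStructure R M) where
  smul g φ :=
    { mul := (φ.mul.compl₁₂ (g.symm : M →ₗ[R] M) (g.symm : M →ₗ[R] M)).compr₂ (g : M →ₗ[R] M)
      assoc := fun x y z => by simp [φ.assoc] }
  one_smul φ := by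
    ext x y
    rfl
  mul_smul g h φ := by
    ext x y
    rfl

@[simp]
theorem smul_mul_apply (g : M ≃ₗ[R] M) (φ : AssocStructure R M) (x y : M) :
    (g • φ).mul x y = g (φ.mul (g.symm x) (g.symm y)) := rfl

end General

end AssocStructure

section Zariski

variable (K : Type*) (W : Type*) [Field K] [AddCommGroup W] [Module K W]

/-- The algebra of polynomial functions on a vector space: the functions that are polynomial
expressions in linear functionals. -/
def vectorPolyFunctions : Subalgebra K (W → K) :=
  Algebra.adjoin K (Set.range fun l : Module.Dual K W => (l : W → K))

/-- The Zariski topology on a vector space: the closed sets are the common zero loci of sets of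
polynomial functions. -/
abbrev zariskiTopologyOn : TopologicalSpace W :=
  TopologicalSpace.ofClosed
    {Z | ∃ F : Set (W → K), F ⊆ vectorPolyFunctions K W ∧ Z = {w | ∀ f ∈ F, f w = 0}}
    ⟨{1}, by simp, by simp⟩
    (by
      intro A hA
      refine ⟨{f | f ∈ vectorPolyFunctions K W ∧ ∃ Z ∈ A, ∀ w ∈ Z, f w = 0},
        fun f hf => hf.1, ?_⟩
      ext w
      constructor
      · rintro hw f ⟨-, Z, hZ, hf⟩
        exact hf w (hw Z hZ)
      · intro hw Z hZ
        obtain ⟨F, hF, rfl⟩ := hA hZ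
        intro f hf
        exact hw f ⟨hF hf, _, hZ, fun w' hw' => hw' f hf⟩)
    (by
      rintro _ ⟨F, hF, rfl⟩ _ ⟨G, hG, rfl⟩
      refine ⟨{h | ∃ f ∈ F, ∃ g ∈ G, h = f * g}, ?_, ?_⟩
      · rintro _ ⟨f, hf, g, hg, rfl⟩
        exact mul_mem (hF hf) (hG hg)
      · ext w
        constructor
        · rintro (hw | hw) _ ⟨f, hf, g, hg, rfl⟩
          · simp [hw f hf]
          · simp [hw g hg]
        · intro hw
          by_contra hcon
          simp only [Set.mem_union, Set.mem_ofPred_eq, not_or, not_forall] at hcon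
          obtain ⟨⟨f, hf, hfw⟩, g, hg, hgw⟩ := hcon
          exact mul_ne_zero hfw hgw (hw _ ⟨f, hf, g, hg, rfl⟩))

end Zariski

namespace AssocStructure

section Field

variable {K : Type*} {V : Type*} [Field K] [AddCommGroup V] [Module K V]

/-- The Zariski topology on the variety of associative algebra structures on `V`, as a subspace
of the vector space of all bilinear maps `V × V → V`. -/
instance : TopologicalSpace (AssocStructure K V) :=
  TopologicalSpace.induced mul (zariskiTopologyOn K (V →ₗ[K] V →ₗ[K] V))

/-- `B` is a degeneration of `A` if the orbit of `B` under `GL(V)` is contained in the Zariski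
closure of the orbit of `A`. -/
def IsDegenerationOf (B A : AssocStructure K V) : Prop :=
  MulAction.orbit (V ≃ₗ[K] V) B ⊆ closure (MulAction.orbit (V ≃ₗ[K] V) A)

end Field

end AssocStructure

section Deformation

/-- `K` as an algebra over `K⟦X⟧` through evaluation at zero `f ↦ f(0)`. -/
noncomputable abbrev evalZeroAlgebra (K : Type*) [Field K] : Algebra K⟦X⟧ K :=
  (PowerSeries.constantCoeff (R := K)).toAlgebra

attribute [local instance] evalZeroAlgebra

/-- A Gerstenhaber formal deformation of an algebra structure `B` on the `K`-vector space `V`: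
an associative `K⟦X⟧`-algebra `carrier` that is torsion-free and complete (that is, separated
and complete in the `X`-adic topology) as a `K⟦X⟧`-module, together with an isomorphism of
`K`-algebras from its specialization at zero `K ⊗[K⟦X⟧] carrier` to `(V, B)`. -/
structure FormalDeformation {K : Type u} {V : Type v} [Field K] [AddCommGroup V] [Module K V]
    (B : AssocStructure K V) where
  carrier : Type w
  [addCommGroup : AddCommGroup carrier]
  [module : Module K⟦X⟧ carrier]
  alg : AssocStructure K⟦X⟧ carrier
  torsionFree : Module.IsTorsionFree K⟦X⟧ carrier
  complete : IsAdicComplete (Ideal.span {(PowerSeries.X : K⟦X⟧)}) carrier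
  specialization : K ⊗[K⟦X⟧] carrier ≃ₗ[K] V
  specialization_mul : ∀ x y, specialization ((alg.baseChange K).mul x y) =
    B.mul (specialization x) (specialization y)

attribute [instance] FormalDeformation.addCommGroup FormalDeformation.module

end Deformation

/-! Both directions are read off structure constants in a basis. Deformation to degeneration: a
complete torsion-free `K⟦X⟧`-module with finite-dimensional special fibre is finite
(`PowerSeries.finite_of_isAdicComplete`), hence free. Over `K⸨X⸩` its structure constants are those
of `A` transported by an invertible matrix, so they satisfy every polynomial vanishing on the orbit
of `A`: such a polynomial vanishes identically on a generic matrix, because `K` is infinite. The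
constants lie in `K⟦X⟧`, and setting `X = 0` gives the same equations for `B`.

Degeneration to deformation: one needs a formal arc of structure constants through `B` together with
a matrix over `K⸨X⸩` carrying `A` to it. The entries of the generic matrix may have poles where the
constants tend to `B`, so `exists_finiteType_subalgebra_isMaximal` uses a valuation centred at `B`
to pick a chart on which they become regular after division by one element `z`. Curve selection
(`Ideal.exists_algHom_powerSeries`) then gives an arc through a point of that chart along which
neither `z⁻¹` nor the determinant vanishes identically. Associativity of the resulting
multiplication is inherited from `A` over `K⸨X⸩`.

Curve selection cuts the local ring down to dimension one, dominates it by a valuation ring of its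
fraction field, shows by the Krull–Akizuki argument that this ring is discrete, and expands in a
uniformizer. -/

/-! ### Curve selection: formal arcs through closed points -/

/-- Since the residue field is `K`, each element can be written as a constant plus `u` times a
remainder, for a uniformizer `u`; iterating on the remainder gives its power series in `u`. -/
theorem IsDiscreteValuationRing.exists_algHom_powerSeries {K O : Type*} [Field K] [CommRing O]
    [IsDomain O] [IsDiscreteValuationRing O] [Algebra K O]
    (hres : ∀ x : O, ∃ a : K, x - algebraMap K O a ∈ IsLocalRing.maximalIdeal O) :
    ∃ θ : O →ₐ[K] K⟦X⟧, Function.Injective θ ∧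
      ∀ x ∈ IsLocalRing.maximalIdeal O, PowerSeries.constantCoeff (θ x) = 0 := by
  obtain ⟨u, hu⟩ := IsDiscreteValuationRing.exists_irreducible O
  have hum : IsLocalRing.maximalIdeal O = Ideal.span {u} := hu.maximalIdeal_eq
  have hu0 : u ≠ 0 := hu.ne_zero
  have hbij : Function.Bijective (Algebra.ofId K (IsLocalRing.ResidueField O)) := by
    refine ⟨(algebraMap K (IsLocalRing.ResidueField O)).injective, fun y => ?_⟩
    obtain ⟨x, rfl⟩ := IsLocalRing.residue_surjective y
    obtain ⟨a, ha⟩ := hres x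
    refine ⟨a, ?_⟩
    rw [← IsLocalRing.residue_eq_zero_iff, map_sub, sub_eq_zero] at ha
    rw [ha]
    rfl
  let e := AlgEquiv.ofBijective _ hbij
  let ρ : O →ₐ[K] K := (e.symm : IsLocalRing.ResidueField O →ₐ[K] K).comp
    (IsScalarTower.toAlgHom K O (IsLocalRing.ResidueField O))
  have hρ : ∀ x : O, ρ x = 0 ↔ x ∈ IsLocalRing.maximalIdeal O := by
    intro x
    rw [← IsLocalRing.residue_eq_zero_iff]
    change e.symm _ = 0 ↔ _
    rw [EmbeddingLike.map_eq_zero_iff]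
    rfl
  have hex : ∀ x : O, ∃ y, x = algebraMap K O (ρ x) + u * y := by
    intro x
    have : x - algebraMap K O (ρ x) ∈ IsLocalRing.maximalIdeal O := by
      rw [← hρ, map_sub, AlgHom.commutes]
      simp
    rw [hum, Ideal.mem_span_singleton] at this
    obtain ⟨y, hy⟩ := this
    exact ⟨y, by rw [← hy]; ring⟩
  choose r₀ hr₀ using hex
  -- Cancelling `u` makes the remainder unique; every law for `r` below follows from this.
  have huniq : ∀ (x y : O), x = algebraMap K O (ρ x) + u * y → r₀ x = y := by
    intro x y h
    exact mul_left_cancel₀ hu0 (add_left_cancel ((hr₀ x).symm.trans h))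
  have hadd : ∀ x y, r₀ (x + y) = r₀ x + r₀ y := by
    intro x y
    apply huniq
    conv_lhs => rw [hr₀ x, hr₀ y]
    simp only [map_add]
    ring
  let r : O →+ O := AddMonoidHom.mk' r₀ hadd
  have hr : ∀ x, x = algebraMap K O (ρ x) + u * r x := hr₀
  have hrmul : ∀ x y, r (x * y) = algebraMap K O (ρ x) * r y + r x * y := by
    intro x y
    apply huniq
    have hx := hr x
    have hy := hr y
    rw [map_mul, map_mul]
    linear_combination y * hx + algebraMap K O (ρ x) * hy
  have hralg : ∀ a : K, r (algebraMap K O a) = 0 := by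
    intro a
    apply huniq
    simp
  let c : O → K⟦X⟧ := fun x => PowerSeries.mk fun n => ρ (r^[n] x)
  have hc : ∀ x, c x = PowerSeries.C (ρ x) + PowerSeries.X * c (r x) := by
    intro x
    ext n
    cases n with
    | zero => simp [c]
    | succ n =>
      rw [map_add, PowerSeries.coeff_succ_X_mul, PowerSeries.coeff_C]
      simp [c]
  have hcadd : ∀ x y, c (x + y) = c x + c y := by
    intro x y
    ext n
    simp [c, iterate_map_add]
  have hczero : c 0 = 0 := by
    ext n
    simp [c, iterate_map_zero]
  have hcalg : ∀ a : K, c (algebraMap K O a) = PowerSeries.C a := by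
    intro a
    rw [hc, hralg, hczero]
    simp
  -- The twisted Leibniz rule `hrmul` lowers the degree by one but changes both factors, so the
  -- induction runs over all pairs at once.
  have hcmul : ∀ x y, c (x * y) = c x * c y := by
    intro x y
    ext n
    induction n generalizing x y with
    | zero =>
      rw [hc, hc x, hc y]
      simp
    | succ n ih =>
      have h1 : c (x * y) = PowerSeries.C (ρ x) * PowerSeries.C (ρ y) +
          PowerSeries.X * (c (algebraMap K O (ρ x) * r y) + c (r x * y)) := by
        rw [hc (x * y), hrmul, hcadd, map_mul, map_mul]
      have h2 : c x * c y = PowerSeries.C (ρ x) * PowerSeries.C (ρ y) +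
          PowerSeries.X * (c (algebraMap K O (ρ x)) * c (r y) + c (r x) * c y) := by
        rw [hcalg]
        linear_combination c y * hc x + PowerSeries.C (ρ x) * hc y
      rw [h1, h2, map_add, map_add, PowerSeries.coeff_succ_X_mul, PowerSeries.coeff_succ_X_mul,
        map_add, map_add, ih, ih]
  let θ : O →ₐ[K] K⟦X⟧ :=
    { toFun := c
      map_one' := by simpa using hcalg 1
      map_mul' := hcmul
      map_zero' := hczero
      map_add' := hcadd
      commutes' := hcalg }
  have hθu : θ u = PowerSeries.X := by
    have h1 : ρ u = 0 := by
      rw [hρ, hum]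
      exact Ideal.mem_span_singleton_self u
    have h2 : r u = 1 := huniq _ _ (by rw [h1]; simp)
    change c u = _
    rw [hc, h1, h2]
    have : c 1 = 1 := by simpa using hcalg 1
    simp [this]
  refine ⟨θ, ?_, ?_⟩
  · rw [injective_iff_map_eq_zero]
    intro x hx
    by_contra hx0
    obtain ⟨n, v, rfl⟩ := IsDiscreteValuationRing.eq_unit_mul_pow_irreducible hx0 hu
    rw [map_mul, map_pow, hθu] at hx
    have hv : IsUnit (θ (v : O)) := v.isUnit.map θ
    rcases mul_eq_zero.1 hx with h | h
    · exact hv.ne_zero h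
    · exact pow_ne_zero n PowerSeries.X_ne_zero h
  · intro x hx
    have : θ x = PowerSeries.C (ρ x) + PowerSeries.X * c (r x) := hc x
    rw [this, (hρ x).2 hx]
    simp

/-- Krull's principal ideal theorem and prime avoidance. A prime minimal over a nonzero nonunit `x`
has height at most one and contains `h`, so it is itself minimal over `h`. Hence the maximal ideal
is covered by the finitely many minimal primes of `h`, equals one of them, and has height at most
one. -/
theorem Ideal.eq_maximalIdeal_of_forall_isPrime_mem {D : Type*} [CommRing D] [IsDomain D]
    [IsNoetherianRing D] [IsLocalRing D] {h : D} (h0 : h ≠ 0)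
    (hh : ∀ p : Ideal D, p.IsPrime → p ≠ ⊥ → h ∈ p) {p : Ideal D} (hp : p.IsPrime)
    (hp0 : p ≠ ⊥) : p = IsLocalRing.maximalIdeal D := by
  have key : ∀ q p : Ideal D, q.IsPrime → q ≠ ⊥ → p.IsPrime → p.height ≤ 1 → q ≤ p → q = p := by
    intro q p hq hq0 hp hht hqp
    by_contra hne
    have hlt : q < p := lt_of_le_of_ne hqp hne
    have h1 := (Ideal.height_le_iff (p := p) (n := 1)).1 (by exact_mod_cast hht) q hq hlt
    have h2 : q.height = 0 := by simpa using h1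
    rw [Ideal.height_eq_zero_iff] at h2
    rw [IsDomain.minimalPrimes_eq_singleton_bot] at h2
    exact hq0 h2
  have hpm : p ≤ IsLocalRing.maximalIdeal D := IsLocalRing.le_maximalIdeal hp.ne_top
  have hhm : h ∈ IsLocalRing.maximalIdeal D := hpm (hh p hp hp0)
  have hspan : Ideal.span {h} ≤ IsLocalRing.maximalIdeal D := by
    rwa [Ideal.span_singleton_le_iff_mem]
  have hne : ∀ q ∈ (Ideal.span {h}).minimalPrimes, q ≠ ⊥ := by
    rintro q hq rfl
    exact h0 (by simpa [Ideal.span_singleton_le_iff_mem] using hq.1.2)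
  have hsub : (IsLocalRing.maximalIdeal D : Set D) ⊆
      ⋃ q ∈ (Ideal.span {h}).minimalPrimes, (q : Set D) := by
    intro x hx
    by_contra hxn
    simp only [Set.mem_iUnion, not_exists] at hxn
    have hx0 : x ≠ 0 := by
      rintro rfl
      obtain ⟨q, hq, -⟩ := Ideal.exists_minimalPrimes_le hspan
      exact hxn q hq q.zero_mem
    obtain ⟨p', hp', -⟩ := Ideal.exists_minimalPrimes_le
      (show Ideal.span {x} ≤ IsLocalRing.maximalIdeal D by rwa [Ideal.span_singleton_le_iff_mem])
    have hxp' : x ∈ p' := (Ideal.span_singleton_le_iff_mem _).1 hp'.1.2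
    have hp'0 : p' ≠ ⊥ := by
      rintro rfl
      exact hx0 hxp'
    have := hp'.1.1
    have hhp' : Ideal.span {h} ≤ p' := (Ideal.span_singleton_le_iff_mem _).2 (hh p' this hp'0)
    obtain ⟨q, hq, hqp'⟩ := Ideal.exists_minimalPrimes_le hhp'
    have := key q p' hq.1.1 (hne q hq) hp'.1.1
      (Ideal.height_le_one_of_isPrincipal_of_mem_minimalPrimes _ _ hp') hqp'
    exact hxn q hq (this ▸ hxp')
  obtain ⟨q, hq, hmq⟩ := (Ideal.subset_union_prime_finite
    (Ideal.finite_minimalPrimes_of_isNoetherianRing D (Ideal.span {h})) (f := id) ⊤ ⊤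
    (fun i hi _ _ => hi.1.1)).1 hsub
  have hqm : q = IsLocalRing.maximalIdeal D :=
    le_antisymm (IsLocalRing.le_maximalIdeal hq.1.1.ne_top) hmq
  exact key p _ hp hp0 inferInstance
    (hqm ▸ Ideal.height_le_one_of_isPrincipal_of_mem_minimalPrimes _ _ hq) hpm

/-- The finiteness statement at the heart of the Krull–Akizuki theorem. -/
theorem isNoetherian_quotient_span_of_birational {D B : Type*} [CommRing D] [IsNoetherianRing D]
    [CommRing B] [IsDomain B] [Algebra D B] {a : D} (ha : algebraMap D B a ≠ 0)
    [IsArtinianRing (D ⧸ Ideal.span {a})]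
    (hfrac : ∀ b : B, ∃ (m : ℕ) (d : D), algebraMap D B a ^ m * b = algebraMap D B d) :
    IsNoetherian D (B ⧸ Ideal.span {algebraMap D B a}) := by
  set α := algebraMap D B a with hα
  -- The images of `α ^ n B ∩ D` in the Artinian ring `D ⧸ (a)` decrease, so they stabilize at some
  -- `n₀`.
  let J : ℕ → Ideal (D ⧸ Ideal.span {a}) := fun n =>
    ((Ideal.span {α ^ n}).comap (algebraMap D B)).map (Ideal.Quotient.mk _)
  have hJ : Antitone J := fun m n hmn => Ideal.map_mono (Ideal.comap_mono
    (Ideal.span_singleton_le_span_singleton.2 (pow_dvd_pow α hmn)))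
  obtain ⟨n₀, hn₀⟩ := IsArtinian.monotone_stabilizes
    (⟨fun n => OrderDual.toDual (J n), fun m n h => hJ h⟩ : ℕ →o (Ideal (D ⧸ Ideal.span {a}))ᵒᵈ)
  have hstep : ∀ n, n₀ ≤ n → J n = J (n + 1) := fun n hn =>
    (hn₀ n hn).symm.trans (hn₀ (n + 1) (by omega))
  -- Stability replaces `d`, modulo `a`, by an element divisible by one more power of `α`; a factor
  -- `α` then cancels and the exponent drops to `n₀`.
  have hdesc : ∀ x : B, ∀ k, (∃ y d, α ^ (n₀ + k) * x = α ^ (n₀ + k + 1) * y + algebraMap D B d) →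
      ∃ y d, α ^ n₀ * x = α ^ (n₀ + 1) * y + algebraMap D B d := by
    intro x k
    induction k with
    | zero => exact id
    | succ k ih =>
      rintro ⟨y, d, h⟩
      apply ih
      have hd : d ∈ (Ideal.span {α ^ (n₀ + (k + 1))}).comap (algebraMap D B) := by
        rw [Ideal.mem_comap, Ideal.mem_span_singleton]
        exact ⟨x - α * y, by linear_combination -h⟩
      have hd' : Ideal.Quotient.mk (Ideal.span {a}) d ∈ J (n₀ + (k + 1)) :=
        Ideal.mem_map_of_mem _ hd
      rw [hstep _ (by omega)] at hd'
      obtain ⟨d', hd'1, hd'2⟩ :=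
        (Ideal.mem_map_iff_of_surjective _ Ideal.Quotient.mk_surjective).1 hd'
      rw [Ideal.mem_comap, Ideal.mem_span_singleton] at hd'1
      obtain ⟨y', hy'⟩ := hd'1
      rw [Ideal.Quotient.eq, Ideal.mem_span_singleton] at hd'2
      obtain ⟨e, he⟩ := hd'2
      have he' : algebraMap D B d' - algebraMap D B d = α * algebraMap D B e := by
        rw [← map_sub, he, map_mul]
      refine ⟨y + y', -e, mul_left_cancel₀ ha ?_⟩
      rw [map_neg]
      linear_combination h + hy' - he'
  have hall : ∀ x : B, ∃ y d, α ^ n₀ * x = α ^ (n₀ + 1) * y + algebraMap D B d := by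
    intro x
    obtain ⟨m, d, hd⟩ := hfrac x
    refine hdesc x m ⟨0, a ^ n₀ * d, ?_⟩
    rw [map_mul, map_pow, ← hd]
    ring
  -- Multiplication by `α ^ n₀` embeds `B ⧸ (α)` into `B ⧸ (α ^ (n₀ + 1))`, and by `hall` its image
  -- lies in the cyclic `D`-module generated by `1`.
  let f : D →ₗ[D] (B ⧸ Ideal.span {α ^ (n₀ + 1)}) :=
    Algebra.linearMap D (B ⧸ Ideal.span {α ^ (n₀ + 1)})
  let g : (B ⧸ Ideal.span {α}) →ₗ[B] (B ⧸ Ideal.span {α ^ (n₀ + 1)}) :=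
    Submodule.mapQ (Ideal.span {α}) (Ideal.span {α ^ (n₀ + 1)}) (LinearMap.mulLeft B (α ^ n₀)) (by
      intro x hx
      rw [Ideal.mem_span_singleton] at hx
      obtain ⟨y, rfl⟩ := hx
      rw [Submodule.mem_comap, LinearMap.mulLeft_apply, Ideal.mem_span_singleton]
      exact ⟨y, by ring⟩)
  have hgf : ∀ x, (g.restrictScalars D) x ∈ LinearMap.range f := by
    intro x
    obtain ⟨x, rfl⟩ := Submodule.Quotient.mk_surjective _ x
    obtain ⟨y, d, h⟩ := hall x
    refine ⟨d, ?_⟩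
    change Ideal.Quotient.mk _ (algebraMap D B d) = Ideal.Quotient.mk _ (α ^ n₀ * x)
    rw [Ideal.Quotient.eq, Ideal.mem_span_singleton]
    exact ⟨-y, by linear_combination -h⟩
  refine isNoetherian_of_injective (LinearMap.codRestrict _ (g.restrictScalars D) hgf) ?_
  rw [← LinearMap.ker_eq_bot, LinearMap.ker_codRestrict, LinearMap.ker_eq_bot']
  intro x hx
  obtain ⟨x, rfl⟩ := Submodule.Quotient.mk_surjective _ x
  have hx' : Ideal.Quotient.mk (Ideal.span {α ^ (n₀ + 1)}) (α ^ n₀ * x) = 0 := hx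
  rw [Ideal.Quotient.eq_zero_iff_mem, Ideal.mem_span_singleton] at hx'
  obtain ⟨y, hy⟩ := hx'
  rw [Submodule.Quotient.mk_eq_zero, Ideal.mem_span_singleton]
  exact ⟨y, mul_left_cancel₀ (pow_ne_zero n₀ ha) (by rw [hy]; ring)⟩

/-- By Krull–Akizuki, `B ⧸ (a)` is Noetherian over `D`. This makes `B` Noetherian, hence a discrete
valuation ring, and makes its residue field finite over `D`, hence integral over `K` and equal to
it. The arc is the expansion in `B`. -/
theorem exists_algHom_powerSeries_of_dominates {K D B : Type*} [Field K] [IsAlgClosed K]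
    [CommRing D] [IsNoetherianRing D] [IsLocalRing D] [Algebra K D]
    (hresD : ∀ x : D, ∃ a : K, x - algebraMap K D a ∈ IsLocalRing.maximalIdeal D)
    [CommRing B] [IsDomain B] [ValuationRing B] [Algebra D B]
    (hinj : Function.Injective (algebraMap D B)) [IsLocalHom (algebraMap D B)]
    (hfrac : ∀ b : B, ∃ c d : D, c ≠ 0 ∧ algebraMap D B c * b = algebraMap D B d)
    {a : D} (ha : a ≠ 0) (ham : a ∈ IsLocalRing.maximalIdeal D)
    (hdim : ∀ p : Ideal D, p.IsPrime → p ≠ ⊥ → p = IsLocalRing.maximalIdeal D) :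
    ∃ θ : D →ₐ[K] K⟦X⟧, Function.Injective θ ∧
      ∀ x ∈ IsLocalRing.maximalIdeal D, PowerSeries.constantCoeff (θ x) = 0 := by
  have hmin : IsLocalRing.maximalIdeal D ∈ (Ideal.span {a}).minimalPrimes := by
    refine ⟨⟨inferInstance, (Ideal.span_singleton_le_iff_mem _).2 ham⟩, fun p hp _ => ?_⟩
    refine (hdim p hp.1 ?_).ge
    rintro rfl
    exact ha ((Ideal.span_singleton_le_iff_mem _).1 hp.2)
  have hart := IsLocalRing.quotient_artinian_of_mem_minimalPrimes_of_isLocalRing _ hmin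
  have hdvd : ∀ c : D, c ≠ 0 → ∃ m : ℕ, c ∣ a ^ m := by
    intro c hc
    have : a ∈ (Ideal.span {c}).radical := by
      rw [Ideal.radical_eq_sInf, Submodule.mem_sInf]
      rintro p ⟨hcp, hp⟩
      rw [hdim p hp]
      · exact ham
      · rintro rfl
        exact hc ((Ideal.span_singleton_le_iff_mem _).1 hcp)
    obtain ⟨m, hm⟩ := this
    exact ⟨m, Ideal.mem_span_singleton.1 hm⟩
  have ha' : algebraMap D B a ≠ 0 := by
    rwa [Ne, map_eq_zero_iff _ hinj]
  have hnoeth : IsNoetherian D (B ⧸ Ideal.span {algebraMap D B a}) := by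
    refine isNoetherian_quotient_span_of_birational ha' fun b => ?_
    obtain ⟨c, d, hc, h⟩ := hfrac b
    obtain ⟨m, e, he⟩ := hdvd c hc
    refine ⟨m, e * d, ?_⟩
    rw [← map_pow, he, map_mul, map_mul, ← h]
    ring
  have hnoethB : IsNoetherian B (B ⧸ Ideal.span {algebraMap D B a}) := isNoetherian_of_tower D hnoeth
  have hB : IsNoetherianRing B := by
    -- Only nonzero primes need to be finitely generated. Such a `Q` meets `D` in a nonzero, hence
    -- maximal, ideal; so `Q` contains `a`, and its image in `B ⧸ (a)` is finitely generated.
    refine IsNoetherianRing.of_prime_ne_bot fun Q hQ hQ0 => ?_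
    obtain ⟨x, hxQ, hx0⟩ := Submodule.exists_mem_ne_zero_of_ne_bot hQ0
    obtain ⟨c, d, hc, h⟩ := hfrac x
    have hd : d ∈ Q.comap (algebraMap D B) := by
      rw [Ideal.mem_comap, ← h]
      exact Q.mul_mem_left _ hxQ
    have hd0 : d ≠ 0 := by
      rintro rfl
      rw [map_zero, mul_eq_zero, map_eq_zero_iff _ hinj] at h
      exact h.elim hc hx0
    have haQ : algebraMap D B a ∈ Q := by
      have := hdim (Q.comap (algebraMap D B)) inferInstance (by
        intro hbot
        rw [hbot] at hd
        exact hd0 hd)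
      rw [← Ideal.mem_comap, this]
      exact ham
    refine Submodule.fg_of_fg_map_of_fg_inf_ker (Ideal.span {algebraMap D B a}).mkQ
      (IsNoetherian.noetherian _) ?_
    rw [Submodule.ker_mkQ, inf_eq_right.2 ((Ideal.span_singleton_le_iff_mem _).2 haQ)]
    exact ⟨{algebraMap D B a}, by simp⟩
  have haB : algebraMap D B a ∈ IsLocalRing.maximalIdeal B := by
    rw [IsLocalRing.mem_maximalIdeal, mem_nonunits_iff, isUnit_map_iff]
    exact ham
  have hfield : ¬ IsField B := by
    rw [IsLocalRing.isField_iff_maximalIdeal_eq]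
    intro hbot
    rw [hbot] at haB
    exact ha' haB
  have hdvr : IsDiscreteValuationRing B :=
    ((IsDiscreteValuationRing.TFAE B hfield).out 1 0).1 ‹_›
  let : Algebra K B := ((algebraMap D B).comp (algebraMap K D)).toAlgebra
  have hKB : ∀ k, algebraMap K B k = algebraMap D B (algebraMap K D k) := fun k => rfl
  have hKbij : Function.Bijective (algebraMap K (IsLocalRing.ResidueField D)) := by
    refine ⟨(algebraMap K (IsLocalRing.ResidueField D)).injective, fun y => ?_⟩
    obtain ⟨x, rfl⟩ := IsLocalRing.residue_surjective y
    obtain ⟨a, ha⟩ := hresD x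
    refine ⟨a, ?_⟩
    rw [← IsLocalRing.residue_eq_zero_iff, map_sub, sub_eq_zero] at ha
    rw [ha]
    rfl
  have hfin : Module.Finite D (IsLocalRing.ResidueField B) := by
    let q : (B ⧸ Ideal.span {algebraMap D B a}) →+* IsLocalRing.ResidueField B :=
      Ideal.Quotient.factor ((Ideal.span_singleton_le_iff_mem _).2 haB)
    let q' : (B ⧸ Ideal.span {algebraMap D B a}) →ₗ[D] IsLocalRing.ResidueField B :=
      { q with
        map_smul' := by
          intro d x
          obtain ⟨x, rfl⟩ := Ideal.Quotient.mk_surjective x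
          change q (Ideal.Quotient.mk _ (d • x)) = d • q (Ideal.Quotient.mk _ x)
          rw [Algebra.smul_def, Algebra.smul_def, map_mul, map_mul]
          rfl }
    refine Module.Finite.of_surjective q' ?_
    intro y
    obtain ⟨x, rfl⟩ := IsLocalRing.residue_surjective y
    exact ⟨Ideal.Quotient.mk _ x, rfl⟩
  have : Algebra.IsIntegral (IsLocalRing.ResidueField D) (IsLocalRing.ResidueField B) :=
    Algebra.IsIntegral.tower_top D
  have : Algebra.IsIntegral K (IsLocalRing.ResidueField D) :=
    ⟨fun x => (hKbij.2 x).elim fun k hk => hk ▸ isIntegral_algebraMap⟩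
  have : IsScalarTower K (IsLocalRing.ResidueField D) (IsLocalRing.ResidueField B) :=
    IsScalarTower.of_algebraMap_eq fun _ => rfl
  have : Algebra.IsIntegral K (IsLocalRing.ResidueField B) :=
    Algebra.IsIntegral.trans (IsLocalRing.ResidueField D)
  have hsurj := (IsAlgClosed.algebraMap_bijective_of_isIntegral
    (k := K) (K := IsLocalRing.ResidueField B)).2
  have hresB : ∀ x : B, ∃ a : K, x - algebraMap K B a ∈ IsLocalRing.maximalIdeal B := by
    intro x
    obtain ⟨y, hy⟩ := hsurj (IsLocalRing.residue B x)
    refine ⟨y, ?_⟩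
    rw [← IsLocalRing.residue_eq_zero_iff, map_sub, ← hy, sub_eq_zero]
    rfl
  obtain ⟨θ, hθ, hθm⟩ := IsDiscreteValuationRing.exists_algHom_powerSeries hresB
  let ι : D →ₐ[K] B := { algebraMap D B with commutes' := fun k => rfl }
  refine ⟨θ.comp ι, hθ.comp hinj, fun x hx => hθm _ ?_⟩
  change algebraMap D B x ∈ _
  rw [IsLocalRing.mem_maximalIdeal, mem_nonunits_iff, isUnit_map_iff]
  exact hx

theorem Ideal.exists_sub_algebraMap_mem_of_finiteType {K T : Type*} [Field K] [IsAlgClosed K]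
    [CommRing T] [Algebra K T] [Algebra.FiniteType K T] (M : Ideal T) [M.IsMaximal] (x : T) :
    ∃ a : K, x - algebraMap K T a ∈ M := by
  let : Field (T ⧸ M) := Ideal.Quotient.field M
  have : Algebra.FiniteType K (T ⧸ M) := inferInstance
  have : Module.Finite K (T ⧸ M) := finite_of_finite_type_of_isJacobsonRing K (T ⧸ M)
  obtain ⟨a, ha⟩ := (IsAlgClosed.algebraMap_bijective_of_isIntegral (k := K) (K := T ⧸ M)).2
    (Ideal.Quotient.mk M x)
  refine ⟨a, ?_⟩
  rw [← Ideal.Quotient.eq_zero_iff_mem, map_sub, ← ha, sub_eq_zero]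
  rfl

theorem Localization.AtPrime.exists_sub_algebraMap_mem {K T : Type*} [Field K] [CommRing T]
    [Algebra K T] (M : Ideal T) [M.IsPrime] (hM : ∀ x : T, ∃ a : K, x - algebraMap K T a ∈ M)
    (x : Localization.AtPrime M) :
    ∃ a : K, x - algebraMap K _ a ∈ IsLocalRing.maximalIdeal (Localization.AtPrime M) := by
  have hmem : ∀ t, t ∈ M → algebraMap T (Localization.AtPrime M) t ∈
      IsLocalRing.maximalIdeal (Localization.AtPrime M) := fun t ht =>
    (IsLocalization.AtPrime.to_map_mem_maximal_iff _ M t).2 ht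
  obtain ⟨⟨t, s⟩, hts⟩ := IsLocalization.surj M.primeCompl x
  obtain ⟨τ, hτ⟩ := hM t
  obtain ⟨σ, hσ⟩ := hM s
  have hσ0 : σ ≠ 0 := by
    rintro rfl
    exact s.2 (by simpa using hσ)
  have hs : IsUnit (algebraMap T (Localization.AtPrime M) s) := IsLocalization.map_units _ s
  refine ⟨τ / σ, ?_⟩
  rw [← Ideal.mul_unit_mem_iff_mem _ hs]
  have h1 := hmem _ hτ
  have h2 := hmem _ hσ
  rw [map_sub, ← IsScalarTower.algebraMap_apply] at h1 h2
  have h3 : algebraMap K (Localization.AtPrime M) (τ / σ) * algebraMap K _ σ =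
      algebraMap K _ τ := by
    rw [← map_mul, div_mul_cancel₀ _ hσ0]
  have : (x - algebraMap K (Localization.AtPrime M) (τ / σ)) * algebraMap T _ s =
      (algebraMap T _ t - algebraMap K _ τ) -
        algebraMap K (Localization.AtPrime M) (τ / σ) * (algebraMap T _ s - algebraMap K _ σ) := by
    linear_combination hts - h3
  rw [this]
  exact sub_mem h1 (Ideal.mul_mem_left _ _ h2)

/-- Modulo a prime `P` maximal among those avoiding `h`, every nonzero prime contains `h`, so the
quotient has dimension one while `h` stays nonzero. A valuation ring dominating the quotient
supplies the arc. -/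
theorem IsLocalRing.exists_algHom_powerSeries {K R : Type*} [Field K] [IsAlgClosed K] [CommRing R]
    [IsDomain R] [IsNoetherianRing R] [IsLocalRing R] [Algebra K R]
    (hres : ∀ x : R, ∃ a : K, x - algebraMap K R a ∈ IsLocalRing.maximalIdeal R)
    {h : R} (h0 : h ≠ 0) (hm : h ∈ IsLocalRing.maximalIdeal R) :
    ∃ θ : R →ₐ[K] K⟦X⟧, θ h ≠ 0 ∧
      ∀ x ∈ IsLocalRing.maximalIdeal R, PowerSeries.constantCoeff (θ x) = 0 := by
  obtain ⟨P, ⟨hP, hhP⟩, hPmax⟩ := WellFounded.has_min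
    (wellFounded_gt : WellFounded ((· > ·) : Ideal R → Ideal R → Prop))
    {P | P.IsPrime ∧ h ∉ P} ⟨⊥, Ideal.isPrime_bot, by simpa using h0⟩
  have hloc : IsLocalRing (R ⧸ P) :=
    IsLocalRing.of_surjective' (Ideal.Quotient.mk P) Ideal.Quotient.mk_surjective
  have hmk : IsLocalHom (Ideal.Quotient.mk P) :=
    IsLocalHom.of_surjective _ Ideal.Quotient.mk_surjective
  have hmax : ∀ x, x ∈ IsLocalRing.maximalIdeal R →
      Ideal.Quotient.mk P x ∈ IsLocalRing.maximalIdeal (R ⧸ P) := by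
    intro x hx
    rw [IsLocalRing.mem_maximalIdeal, mem_nonunits_iff, isUnit_map_iff]
    exact hx
  have hresD : ∀ x : R ⧸ P, ∃ a : K,
      x - algebraMap K (R ⧸ P) a ∈ IsLocalRing.maximalIdeal (R ⧸ P) := by
    intro x
    obtain ⟨x, rfl⟩ := Ideal.Quotient.mk_surjective x
    obtain ⟨a, ha⟩ := hres x
    exact ⟨a, by simpa using hmax _ ha⟩
  have hh0 : Ideal.Quotient.mk P h ≠ 0 := by
    rwa [Ne, Ideal.Quotient.eq_zero_iff_mem]
  have hprime : ∀ Q : Ideal (R ⧸ P), Q.IsPrime → Q ≠ ⊥ → Ideal.Quotient.mk P h ∈ Q := by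
    intro Q hQ hQ0
    by_contra hn
    refine hPmax (Q.comap (Ideal.Quotient.mk P)) ⟨inferInstance, hn⟩ ?_
    refine lt_of_le_of_ne (fun x hx => ?_) ?_
    · rw [Ideal.mem_comap, Ideal.Quotient.eq_zero_iff_mem.2 hx]
      exact Q.zero_mem
    · intro heq
      apply hQ0
      rw [eq_bot_iff]
      intro y hy
      obtain ⟨y, rfl⟩ := Ideal.Quotient.mk_surjective y
      have : y ∈ P := by
        rw [heq]
        exact hy
      simpa [Ideal.Quotient.eq_zero_iff_mem] using this
  obtain ⟨B, hB, hBloc⟩ := IsLocalRing.exists_factor_valuationRing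
    (algebraMap (R ⧸ P) (FractionRing (R ⧸ P)))
  let : Algebra (R ⧸ P) B :=
    ((algebraMap (R ⧸ P) (FractionRing (R ⧸ P))).codRestrict B.toSubring hB).toAlgebra
  have hval : ∀ d : R ⧸ P, ((algebraMap (R ⧸ P) B d : B) : FractionRing (R ⧸ P)) =
      algebraMap (R ⧸ P) (FractionRing (R ⧸ P)) d := fun _ => rfl
  have hinj : Function.Injective (algebraMap (R ⧸ P) B) := by
    intro x y hxy
    apply IsFractionRing.injective (R ⧸ P) (FractionRing (R ⧸ P))
    rw [← hval, ← hval, hxy]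
  have : IsLocalHom (algebraMap (R ⧸ P) B) := hBloc
  obtain ⟨θ, hθ, hθm⟩ := exists_algHom_powerSeries_of_dominates (K := K) (D := R ⧸ P) (B := B)
    hresD hinj (by
      intro b
      obtain ⟨d, c, hc, hdc⟩ := IsFractionRing.div_surjective (A := R ⧸ P)
        (b : FractionRing (R ⧸ P))
      refine ⟨c, d, nonZeroDivisors.ne_zero hc, Subtype.ext ?_⟩
      change algebraMap (R ⧸ P) (FractionRing (R ⧸ P)) c * (b : FractionRing (R ⧸ P)) =
        algebraMap (R ⧸ P) (FractionRing (R ⧸ P)) d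
      rw [← hdc, mul_div_cancel₀]
      exact IsFractionRing.to_map_ne_zero_of_mem_nonZeroDivisors hc) hh0 (hmax h hm)
    (fun p hp hp0 => Ideal.eq_maximalIdeal_of_forall_isPrime_mem hh0 hprime hp hp0)
  refine ⟨θ.comp (Ideal.Quotient.mkₐ K P), ?_, fun x hx => hθm _ (hmax x hx)⟩
  change θ (Ideal.Quotient.mk P h) ≠ 0
  rwa [Ne, map_eq_zero_iff θ hθ]

/-- Curve selection: through every closed point of an irreducible affine variety passes a formal
arc that is not contained in a given hypersurface. -/
theorem Ideal.exists_algHom_powerSeries {K T : Type*} [Field K] [IsAlgClosed K]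
    [CommRing T] [IsDomain T] [Algebra K T] [Algebra.FiniteType K T] (M : Ideal T) [M.IsMaximal]
    {h : T} (h0 : h ≠ 0) :
    ∃ θ : T →ₐ[K] K⟦X⟧, θ h ≠ 0 ∧ ∀ x ∈ M, PowerSeries.constantCoeff (θ x) = 0 := by
  have hM := M.exists_sub_algebraMap_mem_of_finiteType (K := K)
  by_cases hhM : h ∈ M
  · have : IsNoetherianRing T := Algebra.FiniteType.isNoetherianRing K T
    have : IsNoetherianRing (Localization.AtPrime M) :=
      IsLocalization.isNoetherianRing M.primeCompl _ inferInstance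
    have hle : M.primeCompl ≤ nonZeroDivisors T := M.primeCompl_le_nonZeroDivisors
    have : IsDomain (Localization.AtPrime M) := IsLocalization.isDomain_localization hle
    have hinj : Function.Injective (algebraMap T (Localization.AtPrime M)) :=
      IsLocalization.injective _ hle
    have hmem : ∀ t, t ∈ M → algebraMap T (Localization.AtPrime M) t ∈
        IsLocalRing.maximalIdeal (Localization.AtPrime M) := fun t ht =>
      (IsLocalization.AtPrime.to_map_mem_maximal_iff _ M t).2 ht
    obtain ⟨θ, hθ, hθm⟩ := IsLocalRing.exists_algHom_powerSeries
      (Localization.AtPrime.exists_sub_algebraMap_mem M hM)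
      (h := algebraMap T (Localization.AtPrime M) h) (by rwa [Ne, map_eq_zero_iff _ hinj])
      (hmem h hhM)
    exact ⟨θ.comp (IsScalarTower.toAlgHom K T (Localization.AtPrime M)), hθ,
      fun x hx => hθm _ (hmem x hx)⟩
  -- When `h` does not vanish at the point, the constant arc suffices.
  · have hbij : Function.Bijective (Algebra.ofId K (T ⧸ M)) := by
      refine ⟨(algebraMap K (T ⧸ M)).injective, fun y => ?_⟩
      obtain ⟨x, rfl⟩ := Ideal.Quotient.mk_surjective y
      obtain ⟨a, ha⟩ := hM x
      refine ⟨a, ?_⟩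
      rw [← Ideal.Quotient.eq_zero_iff_mem, map_sub, sub_eq_zero] at ha
      rw [ha]
      rfl
    let ε : T →ₐ[K] K := ((AlgEquiv.ofBijective _ hbij).symm : (T ⧸ M) →ₐ[K] K).comp
      (Ideal.Quotient.mkₐ K M)
    have hε : ∀ x, ε x = 0 ↔ x ∈ M := by
      intro x
      change (AlgEquiv.ofBijective _ hbij).symm (Ideal.Quotient.mk M x) = 0 ↔ _
      rw [EmbeddingLike.map_eq_zero_iff, Ideal.Quotient.eq_zero_iff_mem]
    refine ⟨(Algebra.ofId K K⟦X⟧).comp ε, ?_, fun x hx => ?_⟩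
    · change algebraMap K K⟦X⟧ (ε h) ≠ 0
      rw [Ne, map_eq_zero_iff _ (algebraMap K K⟦X⟧).injective, hε]
      exact hhM
    · change PowerSeries.constantCoeff (algebraMap K K⟦X⟧ (ε x)) = 0
      rw [(hε x).2 hx]
      simp

/-! ### A chart above a boundary point -/

/-- Given finitely many rational functions `c` regular at a point `b` and finitely many further
rational functions `g`, there is an affine chart of the projective completion of the graph of `g`
with a point above `b`. -/
theorem exists_finiteType_subalgebra_isMaximal {K F α β : Type*} [Field K] [Field F] [Algebra K F]
    [Finite α] [Finite β] (c : α → F) (b : α → K) (g : β → F)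
    (hb : ∀ p : MvPolynomial α K, MvPolynomial.aeval c p = 0 → MvPolynomial.eval b p = 0) :
    ∃ (T : Subalgebra K F) (z : F) (M : Ideal T) (hc : ∀ i, c i ∈ T), T.FG ∧ z ≠ 0 ∧
      z⁻¹ ∈ T ∧ (∀ j, z⁻¹ * g j ∈ T) ∧ M.IsMaximal ∧
      ∀ i, (⟨c i, hc i⟩ - algebraMap K T (b i) : T) ∈ M := by
  let φ : MvPolynomial α K →ₐ[K] F := MvPolynomial.aeval c
  let A : Subring F := (φ : MvPolynomial α K →+* F).range
  let ψ : MvPolynomial α K →+* A := (φ : MvPolynomial α K →+* F).rangeRestrict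
  have hψval : ∀ p, (ψ p : F) = φ p := fun _ => rfl
  let I : Ideal A := Ideal.span (Set.range fun i : α => ψ (MvPolynomial.X i - MvPolynomial.C (b i)))
  -- By `hb`, evaluation at `b` descends to `A = K[c]`, and its kernel contains `I`.
  have hI : I ≠ ⊤ := by
    have hψ : Function.Surjective ψ := RingHom.rangeRestrict_surjective _
    let ε : A →+* K := ψ.liftOfSurjective hψ ⟨MvPolynomial.eval b, by
      intro p hp
      refine hb p ?_
      exact congrArg Subtype.val (show ψ p = 0 from hp)⟩
    have hε : ∀ p, ε (ψ p) = MvPolynomial.eval b p := fun p =>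
      RingHom.liftOfRightInverse_comp_apply _ _ _ _ _
    have hIε : I ≤ RingHom.ker ε := by
      rw [Ideal.span_le]
      rintro _ ⟨i, rfl⟩
      rw [SetLike.mem_coe, RingHom.mem_ker, hε]
      simp
    intro htop
    exact RingHom.ker_ne_top ε (top_le_iff.1 (htop ▸ hIε))
  obtain ⟨O, hAO, hsub_nonunits⟩ := Ideal.image_subset_nonunits_valuationSubring I hI
  have hKO : ∀ a : K, algebraMap K F a ∈ O := fun a =>
    hAO ⟨MvPolynomial.C a, by simp [φ]⟩
  have hcO : ∀ i, c i ∈ O := fun i => hAO ⟨MvPolynomial.X i, by simp [φ]⟩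
  -- Take `z` of largest valuation among `1` and the `g j`; including `1` (the index `none`) forces
  -- `z ≠ 0` and `z⁻¹ ∈ O`.
  obtain ⟨z, hz0, hz1, hzg⟩ : ∃ z : F, z ≠ 0 ∧ z⁻¹ ∈ O ∧ ∀ j, z⁻¹ * g j ∈ O := by
    obtain ⟨i₀, hi₀⟩ := Finite.exists_max (fun o : Option β => O.valuation (o.elim 1 g))
    have hne : O.valuation (i₀.elim 1 g) ≠ 0 := by
      intro h
      have := hi₀ none
      simp [h] at this
    have hle : ∀ o : Option β, (i₀.elim 1 g)⁻¹ * o.elim 1 g ∈ O := by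
      intro o
      rw [← O.valuation_le_one_iff, map_mul, map_inv₀]
      calc _ ≤ (O.valuation (i₀.elim 1 g))⁻¹ * O.valuation (i₀.elim 1 g) := by
            gcongr
            exact hi₀ o
        _ = 1 := inv_mul_cancel₀ hne
    exact ⟨i₀.elim 1 g, by simpa using hne, by simpa using hle none, fun j => hle (some j)⟩
  let S : Set F := Set.range c ∪ ({z⁻¹} ∪ Set.range fun j => z⁻¹ * g j)
  let T : Subalgebra K F := Algebra.adjoin K S
  have hc : ∀ i, c i ∈ T := fun i => Algebra.subset_adjoin (Or.inl ⟨i, rfl⟩)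
  let O' : Subalgebra K F := { O.toSubring with algebraMap_mem' := hKO }
  have hTO : T ≤ O' := by
    refine Algebra.adjoin_le ?_
    rintro x (⟨i, rfl⟩ | rfl | ⟨j, rfl⟩)
    · exact hcO i
    · exact hz1
    · exact hzg j
  let inc : T →+* O := { toFun := fun x => ⟨x, hTO x.2⟩
                         map_one' := rfl
                         map_mul' := fun _ _ => rfl
                         map_zero' := rfl
                         map_add' := fun _ _ => rfl }
  -- The centre of `O` on `T` need not be a closed point; any closed point in its closure still lies
  -- above `b`.
  obtain ⟨M, hM, hle⟩ := Ideal.exists_le_maximal ((IsLocalRing.maximalIdeal O).comap inc)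
    (Ideal.comap_ne_top _ (Ideal.IsPrime.ne_top inferInstance))
  refine ⟨T, z, M, hc, ?_, hz0, ?_, fun j => ?_, hM, fun i => hle ?_⟩
  · exact Subalgebra.fg_def.2
      ⟨S, (Set.finite_range c).union ((Set.finite_singleton _).union (Set.finite_range _)), rfl⟩
  · exact Algebra.subset_adjoin (Or.inr (Or.inl rfl))
  · exact Algebra.subset_adjoin (Or.inr (Or.inr ⟨j, rfl⟩))
  · rw [Ideal.mem_comap]
    have := hsub_nonunits ⟨_, Ideal.subset_span ⟨i, rfl⟩, rfl⟩
    obtain ⟨h1, h2⟩ := ValuationSubring.mem_nonunits_iff_exists_mem_maximalIdeal.1 this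
    convert h2 using 1
    apply Subtype.ext
    change c i - algebraMap K F (b i) = φ (MvPolynomial.X i - MvPolynomial.C (b i))
    simp [φ]

/-! ### Structure constants and their transport -/

section StructureConstants

variable {ι R M N : Type*} [CommRing R] [AddCommGroup M] [Module R M] [AddCommGroup N] [Module R N]

/-- The structure constants of a bilinear multiplication in a basis. -/
noncomputable def structureConstants (b : Module.Basis ι R M) (m : M →ₗ[R] M →ₗ[R] M)
    (x : ι × ι × ι) : R :=
  b.repr (m (b x.1) (b x.2.1)) x.2.2

theorem LinearEquiv.map_mul_of_basis (b : Module.Basis ι R M) {m : M →ₗ[R] M →ₗ[R] M}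
    {m' : N →ₗ[R] N →ₗ[R] N} (e : M ≃ₗ[R] N)
    (h : ∀ i j, e (m (b i) (b j)) = m' (e (b i)) (e (b j))) (x y : M) :
    e (m x y) = m' (e x) (e y) := by
  have : m.compr₂ (e : M →ₗ[R] N) = m'.compl₁₂ (e : M →ₗ[R] N) (e : M →ₗ[R] N) :=
    LinearMap.ext_basis b b fun i j => h i j
  exact LinearMap.congr_fun (LinearMap.congr_fun this x) y

theorem LinearEquiv.map_mul_of_structureConstants_eq (b : Module.Basis ι R M)
    (b' : Module.Basis ι R N) {m : M →ₗ[R] M →ₗ[R] M} {m' : N →ₗ[R] N →ₗ[R] N}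
    (h : structureConstants b m = structureConstants b' m') (x y : M) :
    b.equiv b' (Equiv.refl ι) (m x y) =
      m' (b.equiv b' (Equiv.refl ι) x) (b.equiv b' (Equiv.refl ι) y) := by
  refine LinearEquiv.map_mul_of_basis b _ (fun i j => b'.repr.injective ?_) x y
  ext k
  have := congrFun h (i, j, k)
  simp only [structureConstants] at this
  simpa [Module.Basis.equiv] using this

theorem structureConstants_map (b : Module.Basis ι R M) (e : M ≃ₗ[R] N) {m : M →ₗ[R] M →ₗ[R] M}
    {m' : N →ₗ[R] N →ₗ[R] N} (h : ∀ x y, e (m x y) = m' (e x) (e y)) :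
    structureConstants (b.map e) m' = structureConstants b m := by
  ext x
  simp [structureConstants, ← h]

theorem structureConstants_baseChange {S : Type*} [CommRing S] [Algebra R S]
    (b : Module.Basis ι R M) (m : M →ₗ[R] M →ₗ[R] M) (x : ι × ι × ι) :
    structureConstants (Algebra.TensorProduct.basis S b) (LinearMap.BilinMap.baseChange S m) x =
      algebraMap R S (structureConstants b m x) := by
  rw [structureConstants, structureConstants, Algebra.TensorProduct.basis_apply,
    Algebra.TensorProduct.basis_apply, LinearMap.BilinMap.baseChange_tmul,
    Algebra.TensorProduct.basis_repr_tmul]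
  simp

variable [Fintype ι]

/-- The formula for the structure constants of a transported multiplication, in terms of the
matrices `g` and `g'` of the transporting isomorphism and of its inverse. -/
def transportConstants (a : ι × ι × ι → R) (g g' : Matrix ι ι R) (x : ι × ι × ι) : R :=
  ∑ p, g' p x.1 * ∑ q, g' q x.2.1 * ∑ l, a (p, q, l) * g x.2.2 l

theorem map_transportConstants {S F : Type*} [CommRing S] [FunLike F R S] [RingHomClass F R S]
    (f : F) (a : ι × ι × ι → R) (g g' : Matrix ι ι R) (x : ι × ι × ι) :
    f (transportConstants a g g' x) =
      transportConstants (fun y => f (a y)) (g.map f) (g'.map f) x := by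
  simp [transportConstants, map_sum, map_mul]

theorem transportConstants_smul (a : ι × ι × ι → R) (g g' : Matrix ι ι R) (s t : R)
    (x : ι × ι × ι) :
    transportConstants a (s • g) (t • g') x = s * t ^ 2 * transportConstants a g g' x := by
  simp only [transportConstants, Finset.mul_sum, Matrix.smul_apply, smul_eq_mul]
  refine Finset.sum_congr rfl fun p _ => Finset.sum_congr rfl fun q _ =>
    Finset.sum_congr rfl fun l _ => ?_
  ring

theorem structureConstants_of_equiv [DecidableEq ι] (b : Module.Basis ι R M)
    (b' : Module.Basis ι R N) {m : M →ₗ[R] M →ₗ[R] M}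
    {m' : N →ₗ[R] N →ₗ[R] N} (e : M ≃ₗ[R] N) (h : ∀ x y, e (m x y) = m' (e x) (e y)) :
    structureConstants b' m' = transportConstants (structureConstants b m)
      (LinearMap.toMatrix b b' (e : M →ₗ[R] N)) (LinearMap.toMatrix b' b (e.symm : N →ₗ[R] M)) := by
  have hsum : ∀ i, ∑ p, LinearMap.toMatrix b' b (e.symm : N →ₗ[R] M) p i • b p = e.symm (b' i) :=
    fun i => by
      simp only [LinearMap.toMatrix_apply]
      exact b.sum_repr _
  have hrepr : ∀ (x : M) k, b'.repr (e x) k =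
      ∑ l, b.repr x l * LinearMap.toMatrix b b' (e : M →ₗ[R] N) k l := by
    intro x k
    calc b'.repr (e x) k = b'.repr (e (∑ l, b.repr x l • b l)) k := by rw [b.sum_repr]
      _ = _ := by simp [-Module.Basis.sum_repr, LinearMap.toMatrix_apply]
  ext x
  let Λ : M →ₗ[R] M →ₗ[R] R := m.compr₂ (b'.coord x.2.2 ∘ₗ (e : M →ₗ[R] N))
  have h1 : m' (b' x.1) (b' x.2.1) = e (m (e.symm (b' x.1)) (e.symm (b' x.2.1))) := by
    rw [h]
    simp
  have h2 : structureConstants b' m' x = Λ (e.symm (b' x.1)) (e.symm (b' x.2.1)) := by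
    rw [structureConstants, h1]
    rfl
  rw [h2, ← hsum, ← hsum, LinearMap.map_sum₂]
  refine Finset.sum_congr rfl fun p _ => ?_
  rw [LinearMap.map_smul₂, map_sum, smul_eq_mul]
  congr 1
  refine Finset.sum_congr rfl fun q _ => ?_
  rw [map_smul, smul_eq_mul]
  congr 1
  exact hrepr _ _

/-- Contracting `g` with `g'` gives a factor `d` in each of the two argument slots. The right-hand
side no longer involves `g'`: it is multiplicativity of `g` up to a scalar. -/
theorem sum_mul_transportConstants [DecidableEq ι] (a : ι × ι × ι → R) {g g' : Matrix ι ι R} {d : R}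
    (h : g' * g = d • 1) (i j k : ι) :
    ∑ p, g p i * ∑ q, g q j * transportConstants a g g' (p, q, k) =
      d ^ 2 * ∑ l, a (i, j, l) * g k l := by
  have hcontr : ∀ (y : ι → R) (i : ι), ∑ p, g p i * ∑ q, g' q p * y q = d * y i := by
    intro y i
    simp only [Finset.mul_sum]
    rw [Finset.sum_comm]
    have : ∀ q, ∑ p, g p i * (g' q p * y q) = (g' * g) q i * y q := by
      intro q
      rw [Matrix.mul_apply, Finset.sum_mul]
      exact Finset.sum_congr rfl fun p _ => by ring
    simp [this, h, Matrix.one_apply]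
  have hinner : ∀ p, ∑ q, g q j * transportConstants a g g' (p, q, k) =
      ∑ r, g' r p * (d * ∑ l, a (r, j, l) * g k l) := by
    intro p
    have hswap : ∀ y : ι → ι → R, ∑ q, g q j * ∑ r, g' r p * y r q =
        ∑ r, g' r p * ∑ q, g q j * y r q := by
      intro y
      simp only [Finset.mul_sum]
      rw [Finset.sum_comm]
      exact Finset.sum_congr rfl fun r _ => Finset.sum_congr rfl fun q _ => mul_left_comm _ _ _
    simp only [transportConstants]
    rw [hswap]
    exact Finset.sum_congr rfl fun r _ => congrArg _ (hcontr _ _)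
  simp only [hinner]
  rw [hcontr]
  ring

end StructureConstants

/-! ### Zariski closure in coordinates -/

section Closure

variable {K V ι : Type*} [Field K] [AddCommGroup V] [Module K V]

theorem AssocStructure.mem_closure_iff_forall_vectorPolyFunctions {φ : AssocStructure K V}
    {Y : Set (AssocStructure K V)} :
    φ ∈ closure Y ↔ ∀ f ∈ vectorPolyFunctions K (V →ₗ[K] V →ₗ[K] V),
      (∀ ψ ∈ Y, f ψ.mul = 0) → f φ.mul = 0 := by
  let := zariskiTopologyOn K (V →ₗ[K] V →ₗ[K] V)
  have hclosed : ∀ Z : Set (V →ₗ[K] V →ₗ[K] V), IsClosed Z ↔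
      ∃ F : Set ((V →ₗ[K] V →ₗ[K] V) → K), F ⊆ vectorPolyFunctions K (V →ₗ[K] V →ₗ[K] V) ∧
        Z = {w | ∀ f ∈ F, f w = 0} := by
    intro Z
    rw [← isOpen_compl_iff]
    change Zᶜᶜ ∈ _ ↔ _
    rw [compl_compl]
    rfl
  rw [closure_induced, closure, Set.mem_sInter]
  constructor
  · intro h f hf hY
    refine h {w | f w = 0} ⟨(hclosed _).2 ⟨{f}, by simpa using hf, by simp⟩, ?_⟩
    rintro _ ⟨ψ, hψ, rfl⟩
    exact hY ψ hψ
  · rintro h Z ⟨hZ, hYZ⟩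
    obtain ⟨F, hF, rfl⟩ := (hclosed _).1 hZ
    exact fun f hf => h f (hF hf) fun ψ hψ => hYZ ⟨ψ, hψ, rfl⟩ f hf

theorem exists_mvPolynomial_of_mem_vectorPolyFunctions [Finite ι] (b : Module.Basis ι K V)
    {f : (V →ₗ[K] V →ₗ[K] V) → K} (hf : f ∈ vectorPolyFunctions K (V →ₗ[K] V →ₗ[K] V)) :
    ∃ p : MvPolynomial (ι × ι × ι) K, ∀ m, f m = MvPolynomial.eval (structureConstants b m) p := by
  have := Fintype.ofFinite ι
  classical
  induction hf using Algebra.adjoin_induction with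
  | mem f hf =>
    obtain ⟨l, rfl⟩ := hf
    -- The elementary bilinear maps, in which a multiplication has its structure constants as
    -- coordinates; a linear functional is thus a linear form in those constants.
    let E : ι × ι × ι → (V →ₗ[K] V →ₗ[K] V) := fun x =>
      LinearMap.mk₂ K (fun v w => (b.repr v x.1 * b.repr w x.2.1) • b x.2.2)
        (fun _ _ _ => by simp [add_mul, add_smul]) (fun _ _ _ => by simp [mul_assoc, mul_smul])
        (fun _ _ _ => by simp [mul_add, add_smul])
        (fun _ _ _ => by simp [mul_left_comm, mul_smul])
    have hE : ∀ m, m = ∑ x, structureConstants b m x • E x := by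
      intro m
      refine LinearMap.ext_basis b b fun i j => ?_
      simp only [LinearMap.sum_apply, LinearMap.smul_apply, E, LinearMap.mk₂_apply,
        Module.Basis.repr_self, Fintype.sum_prod_type, Finsupp.single_apply]
      simp [structureConstants, b.sum_repr]
    refine ⟨∑ x, MvPolynomial.C (l (E x)) * MvPolynomial.X x, fun m => ?_⟩
    conv_lhs => rw [hE m]
    simp [mul_comm]
  | algebraMap r => exact ⟨MvPolynomial.C r, fun m => by simp⟩
  | add f g _ _ hf hg =>
    obtain ⟨p, hp⟩ := hf
    obtain ⟨q, hq⟩ := hg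
    exact ⟨p + q, fun m => by simp [hp, hq]⟩
  | mul f g _ _ hf hg =>
    obtain ⟨p, hp⟩ := hf
    obtain ⟨q, hq⟩ := hg
    exact ⟨p * q, fun m => by simp [hp, hq]⟩

theorem eval_structureConstants_mem_vectorPolyFunctions (b : Module.Basis ι K V)
    (p : MvPolynomial (ι × ι × ι) K) :
    (fun m => MvPolynomial.eval (structureConstants b m) p) ∈
      vectorPolyFunctions K (V →ₗ[K] V →ₗ[K] V) := by
  induction p using MvPolynomial.induction_on with
  | C a =>
    simp only [MvPolynomial.eval_C]
    exact (vectorPolyFunctions K (V →ₗ[K] V →ₗ[K] V)).algebraMap_mem a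
  | add p q hp hq =>
    simp only [map_add]
    exact add_mem hp hq
  | mul_X p x hp =>
    simp only [map_mul, MvPolynomial.eval_X]
    refine mul_mem hp (Algebra.subset_adjoin ?_)
    let l : Module.Dual K (V →ₗ[K] V →ₗ[K] V) :=
      b.coord x.2.2 ∘ₗ LinearMap.applyₗ (b x.2.1) ∘ₗ LinearMap.applyₗ (b x.1)
    exact ⟨l, rfl⟩

theorem AssocStructure.mem_closure_iff_forall_mvPolynomial [Finite ι] (b : Module.Basis ι K V)
    {φ : AssocStructure K V} {Y : Set (AssocStructure K V)} :
    φ ∈ closure Y ↔ ∀ p : MvPolynomial (ι × ι × ι) K,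
      (∀ ψ ∈ Y, MvPolynomial.eval (structureConstants b ψ.mul) p = 0) →
        MvPolynomial.eval (structureConstants b φ.mul) p = 0 := by
  rw [AssocStructure.mem_closure_iff_forall_vectorPolyFunctions]
  constructor
  · exact fun h p hp => h _ (eval_structureConstants_mem_vectorPolyFunctions b p) hp
  · intro h f hf hY
    obtain ⟨p, hp⟩ := exists_mvPolynomial_of_mem_vectorPolyFunctions b hf
    rw [hp]
    exact h p fun ψ hψ => (hp _).symm.trans (hY ψ hψ)

end Closure

/-! ### The generic point of an orbit -/

section Generic

variable {ι K : Type*} [Field K]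

variable (ι K) in
/-- The square matrix of indeterminates. -/
noncomputable def genericMatrix : Matrix ι ι (MvPolynomial (Option (ι × ι)) K) :=
  Matrix.of fun i j => MvPolynomial.X (some (i, j))

/-- The matrix of coordinates of a point, forgetting the additional coordinate. -/
def pointMatrix {S : Type*} (v : Option (ι × ι) → S) : Matrix ι ι S :=
  Matrix.of fun i j => v (some (i, j))

theorem map_aeval_genericMatrix {S : Type*} [CommRing S] [Algebra K S] (v : Option (ι × ι) → S) :
    (genericMatrix ι K).map (MvPolynomial.aeval v) = pointMatrix v := by
  ext i j
  simp [genericMatrix, pointMatrix]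

variable [Fintype ι] [DecidableEq ι]

theorem transportConstants_adjugate {R : Type*} [CommRing R] (a : ι × ι × ι → R)
    {g g' : Matrix ι ι R} (h : g' * g = 1) (x : ι × ι × ι) :
    transportConstants a g g.adjugate x = g.det ^ 2 * transportConstants a g g' x := by
  have hadj : g.adjugate = g.det • g' := by
    calc g.adjugate = g.adjugate * (g * g') := by rw [mul_eq_one_comm.1 h, mul_one]
      _ = g.det • g' := by rw [← mul_assoc, Matrix.adjugate_mul, Matrix.smul_mul, one_mul]
  have := transportConstants_smul a g g' 1 g.det x
  rw [one_smul, one_mul] at this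
  rw [hadj, this]

/-- Polynomial expressions which specialize to the structure constants of the algebras isomorphic
to the one with structure constants `a`. -/
noncomputable def genericConstants (a : ι × ι × ι → K) (x : ι × ι × ι) :
    MvPolynomial (Option (ι × ι)) K :=
  MvPolynomial.X none * transportConstants (fun y => algebraMap K _ (a y)) (genericMatrix ι K)
    (genericMatrix ι K).adjugate x

theorem aeval_det_genericMatrix {S : Type*} [CommRing S] [Algebra K S] (v : Option (ι × ι) → S) :
    MvPolynomial.aeval v (genericMatrix ι K).det = (pointMatrix v).det := by
  rw [AlgHom.map_det, AlgHom.mapMatrix_apply, map_aeval_genericMatrix]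

theorem det_genericMatrix_ne_zero : (genericMatrix ι K).det ≠ 0 := by
  intro h
  let v : Option (ι × ι) → K := fun o => o.elim 0 fun x => (1 : Matrix ι ι K) x.1 x.2
  have h1 := aeval_det_genericMatrix (K := K) v
  have h2 : pointMatrix v = 1 := by
    ext i j
    rfl
  rw [h, h2] at h1
  simp at h1

theorem aeval_genericConstants {S : Type*} [CommRing S] [Algebra K S] (v : Option (ι × ι) → S)
    (a : ι × ι × ι → K) (x : ι × ι × ι) :
    MvPolynomial.aeval v (genericConstants a x) = v none *
      transportConstants (fun y => algebraMap K S (a y)) (pointMatrix v)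
        (pointMatrix v).adjugate x := by
  have hadj : (genericMatrix ι K).adjugate.map (MvPolynomial.aeval v) =
      (pointMatrix v).adjugate := by
    rw [← map_aeval_genericMatrix (K := K), ← AlgHom.mapMatrix_apply, ← AlgHom.mapMatrix_apply,
      AlgHom.map_adjugate]
  rw [genericConstants, map_mul, map_transportConstants, map_aeval_genericMatrix, hadj]
  simp

variable {V : Type*} [AddCommGroup V] [Module K V] (b : Module.Basis ι K V)

/-- Transport is linear in the matrix and quadratic in its inverse, so using `s⁻¹ • g` multiplies
the constants by `s`. With `s = t * g.det ^ 2` this accounts for both the adjugate and the free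
factor `t`. -/
theorem AssocStructure.exists_mem_orbit_structureConstants_eq (A : AssocStructure K V)
    {g : Matrix ι ι K} (hg : g.det ≠ 0) {t : K} (ht : t ≠ 0) :
    ∃ ψ ∈ MulAction.orbit (V ≃ₗ[K] V) A, ∀ x, structureConstants b ψ.mul x =
      t * transportConstants (structureConstants b A.mul) g g.adjugate x := by
  set s := t * g.det ^ 2 with hs
  have hs0 : s ≠ 0 := mul_ne_zero ht (pow_ne_zero _ hg)
  have hdet : IsUnit (s⁻¹ • g).det := by
    rw [Matrix.det_smul, isUnit_iff_ne_zero]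
    exact mul_ne_zero (pow_ne_zero _ (inv_ne_zero hs0)) hg
  let e : V ≃ₗ[K] V := Matrix.toLinearEquiv b (s⁻¹ • g) hdet
  have he : LinearMap.toMatrix b b (e : V →ₗ[K] V) = s⁻¹ • g :=
    LinearMap.toMatrix_toLin b b _
  have he' : LinearMap.toMatrix b b (e.symm : V →ₗ[K] V) * (s⁻¹ • g) = 1 := by
    rw [← he, ← LinearMap.toMatrix_comp]
    simp
  have hinv : g⁻¹ * g = 1 := Matrix.nonsing_inv_mul _ (isUnit_iff_ne_zero.2 hg)
  have he'' : LinearMap.toMatrix b b (e.symm : V →ₗ[K] V) = s • g⁻¹ := by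
    calc _ = LinearMap.toMatrix b b (e.symm : V →ₗ[K] V) * ((s⁻¹ • g) * (s • g⁻¹)) := by
          rw [Matrix.smul_mul s⁻¹ g, Matrix.mul_smul g s, mul_eq_one_comm.1 hinv, smul_smul,
            inv_mul_cancel₀ hs0, one_smul, mul_one]
      _ = _ := by rw [← mul_assoc, he', one_mul]
  refine ⟨e • A, ⟨e, rfl⟩, fun x => ?_⟩
  rw [structureConstants_of_equiv b b e (m := A.mul) (m' := (e • A).mul) (fun x y => by simp), he,
    he'', transportConstants_smul, transportConstants_adjugate _ hinv]
  have : s⁻¹ * s ^ 2 = s := by field_simp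
  rw [this, hs]
  ring

/-- The polynomial vanishes wherever `t` and the determinant are nonzero; multiplying by both makes
it vanish everywhere, and over an infinite field the nonzero factor cancels in the polynomial ring.
-/
theorem AssocStructure.aeval_genericConstants_eq_zero [Infinite K] {A : AssocStructure K V}
    {p : MvPolynomial (ι × ι × ι) K}
    (hp : ∀ ψ ∈ MulAction.orbit (V ≃ₗ[K] V) A,
      MvPolynomial.eval (structureConstants b ψ.mul) p = 0) :
    MvPolynomial.aeval (genericConstants (structureConstants b A.mul)) p = 0 := by
  have hmul : MvPolynomial.aeval (genericConstants (structureConstants b A.mul)) p *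
      (MvPolynomial.X none * (genericMatrix ι K).det) = 0 := by
    refine MvPolynomial.funext fun v => ?_
    rw [map_mul, map_mul, map_zero, MvPolynomial.eval_X]
    by_cases ht : v none = 0
    · rw [ht, zero_mul, mul_zero]
    rw [← MvPolynomial.coe_aeval_eq_eval, RingHom.coe_coe, aeval_det_genericMatrix]
    by_cases hg : (pointMatrix v).det = 0
    · rw [hg, mul_zero, mul_zero]
    obtain ⟨ψ, hψ, hψx⟩ := A.exists_mem_orbit_structureConstants_eq b hg ht
    have h1 := hp ψ hψ
    have h2 : structureConstants b ψ.mul = fun x =>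
        MvPolynomial.aeval v (genericConstants (structureConstants b A.mul) x) := by
      ext x
      rw [hψx, aeval_genericConstants]
      rfl
    rw [h2] at h1
    rw [← MvPolynomial.coe_aeval_eq_eval, RingHom.coe_coe, ← MvPolynomial.comp_aeval_apply] at h1
    rw [h1, zero_mul]
  exact (mul_eq_zero.1 hmul).resolve_right
    (mul_ne_zero (MvPolynomial.X_ne_zero _) det_genericMatrix_ne_zero)

theorem AssocStructure.aeval_transportConstants_eq_zero [Infinite K] {A : AssocStructure K V}
    {p : MvPolynomial (ι × ι × ι) K}
    (hp : ∀ ψ ∈ MulAction.orbit (V ≃ₗ[K] V) A,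
      MvPolynomial.eval (structureConstants b ψ.mul) p = 0)
    {S : Type*} [CommRing S] [Algebra K S] {g g' : Matrix ι ι S} (h : g' * g = 1) :
    MvPolynomial.aeval (transportConstants
      (fun y => algebraMap K S (structureConstants b A.mul y)) g g') p = 0 := by
  -- The value `g'.det ^ 2` of the extra variable cancels the `g.det ^ 2` coming from the adjugate.
  let v : Option (ι × ι) → S := fun o => o.elim (g'.det ^ 2) fun x => g x.1 x.2
  have hv : pointMatrix v = g := rfl
  have hdet : g'.det * g.det = 1 := by rw [← Matrix.det_mul, h, Matrix.det_one]
  have h1 := congrArg (MvPolynomial.aeval v) (A.aeval_genericConstants_eq_zero b hp)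
  rw [← AlgHom.comp_apply, MvPolynomial.comp_aeval, map_zero] at h1
  convert h1 using 3
  ext x
  rw [aeval_genericConstants, hv, transportConstants_adjugate _ h, ← mul_assoc]
  change _ = g'.det ^ 2 * g.det ^ 2 * _
  rw [← mul_pow, hdet, one_pow, one_mul]

end Generic

/-! ### Complete modules over `K⟦X⟧` -/

section Complete

theorem PowerSeries.isAdicComplete_pi (K : Type*) [CommRing K] (ι : Type*) [Finite ι] :
    IsAdicComplete (Ideal.span {(PowerSeries.X : K⟦X⟧)}) (ι → K⟦X⟧) := by
  have := Fintype.ofFinite ι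
  classical
  rw [← AdicCompletion.of_bijective_iff]
  let I := Ideal.span {(PowerSeries.X : K⟦X⟧)}
  let e := AdicCompletion.piEquivOfFintype I (fun _ : ι => K⟦X⟧)
  have hof : Function.Bijective (AdicCompletion.of I K⟦X⟧) :=
    AdicCompletion.of_bijective_iff.2 inferInstance
  have he : e ∘ AdicCompletion.of I (ι → K⟦X⟧) =
      fun x i => AdicCompletion.of I K⟦X⟧ (x i) := by
    ext x i n
    rfl
  rw [← Function.Bijective.of_comp_iff' e.bijective, he]
  exact ⟨fun x y h => funext fun i => hof.1 (congrFun h i),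
    fun y => ⟨fun i => (hof.2 (y i)).choose, funext fun i => (hof.2 (y i)).choose_spec⟩⟩

attribute [local instance] evalZeroAlgebra

/-- Lifts of a basis of the special fibre generate modulo `X`, and completeness upgrades this to
generation. -/
theorem PowerSeries.finite_of_isAdicComplete {K M : Type*} [Field K] [AddCommGroup M]
    [Module K⟦X⟧ M] [IsAdicComplete (Ideal.span {(PowerSeries.X : K⟦X⟧)}) M]
    [Module.Finite K (K ⊗[K⟦X⟧] M)] : Module.Finite K⟦X⟧ M := by
  let I := Ideal.span {(PowerSeries.X : K⟦X⟧)}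
  let β : M →ₗ[K⟦X⟧] K ⊗[K⟦X⟧] M := TensorProduct.mk K⟦X⟧ K M 1
  have hβ : Function.Surjective β := by
    intro y
    induction y using TensorProduct.induction_on with
    | zero => exact ⟨0, map_zero _⟩
    | add y z hy hz =>
      obtain ⟨y, rfl⟩ := hy
      obtain ⟨z, rfl⟩ := hz
      exact ⟨y + z, map_add _ _ _⟩
    | tmul a m =>
      refine ⟨PowerSeries.C a • m, ?_⟩
      rw [map_smul]
      change PowerSeries.C a • ((1 : K) ⊗ₜ m) = _
      rw [TensorProduct.smul_tmul', Algebra.smul_def]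
      change (PowerSeries.constantCoeff (PowerSeries.C a) * 1) ⊗ₜ[K⟦X⟧] m = _
      simp
  -- The map `γ` sends `a ⊗ m` to the class of `C a • m`, so the class of `m` modulo `X` is
  -- recovered from `β m`.
  have hker : ∀ m, β m = 0 → m ∈ (I • ⊤ : Submodule K⟦X⟧ M) := by
    intro m hm
    let γ : K →ₗ[K⟦X⟧] M →ₗ[K⟦X⟧] (M ⧸ (I • ⊤ : Submodule K⟦X⟧ M)) :=
      LinearMap.mk₂ K⟦X⟧ (fun a m => Submodule.Quotient.mk (PowerSeries.C a • m))
        (fun a a' m => by rw [map_add, add_smul]; rfl)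
        (fun f a m => by
          rw [Algebra.smul_def, map_mul, mul_smul, ← Submodule.Quotient.mk_smul,
            Submodule.Quotient.eq, ← sub_smul]
          refine Submodule.smul_mem_smul ?_ trivial
          rw [Ideal.mem_span_singleton, PowerSeries.X_dvd_iff]
          change PowerSeries.constantCoeff
            (PowerSeries.C (PowerSeries.constantCoeff f) - f) = 0
          simp)
        (fun a m m' => by rw [smul_add]; rfl)
        (fun f a m => by rw [smul_comm]; rfl)
    have h1 : TensorProduct.lift γ (β m) = Submodule.Quotient.mk m := by
      change Submodule.Quotient.mk (PowerSeries.C 1 • m) = _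
      rw [map_one, one_smul]
    rw [hm, map_zero] at h1
    exact (Submodule.Quotient.mk_eq_zero _).1 h1.symm
  let bK := Module.finBasis K (K ⊗[K⟦X⟧] M)
  choose x hx using fun i => hβ (bK i)
  let f : (Fin (Module.finrank K (K ⊗[K⟦X⟧] M)) → K⟦X⟧) →ₗ[K⟦X⟧] M :=
    Fintype.linearCombination K⟦X⟧ x
  have := PowerSeries.isAdicComplete_pi K (Fin (Module.finrank K (K ⊗[K⟦X⟧] M)))
  refine Module.Finite.of_surjective f (surjective_of_mkQ_comp_surjective (I := I) ?_)
  intro y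
  obtain ⟨m, rfl⟩ := Submodule.Quotient.mk_surjective _ y
  refine ⟨fun i => PowerSeries.C (bK.repr (β m) i), ?_⟩
  change Submodule.Quotient.mk _ = Submodule.Quotient.mk m
  rw [Submodule.Quotient.eq]
  apply hker
  rw [map_sub, sub_eq_zero, Fintype.linearCombination_apply, map_sum]
  conv_rhs => rw [← bK.sum_repr (β m)]
  refine Finset.sum_congr rfl fun i _ => ?_
  rw [map_smul, hx]
  change PowerSeries.constantCoeff (PowerSeries.C (bK.repr (β m) i)) • bK i = _
  simp

end Complete

/-! ### Descending an algebra to a subring -/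

/-- By `hrel`, the invertible `g` is multiplicative over `L`, so the multiplication given by `μ` is
associative there; it is then associative over `R` because `ι → R` embeds into its base change. -/
theorem AssocStructure.exists_isIsomorphic_baseChange {ι K R L V : Type*} [Fintype ι]
    [DecidableEq ι] [CommRing K] [CommRing R] [CommRing L] [Algebra K L] [Algebra R L]
    [AddCommGroup V] [Module K V] (hinj : Function.Injective (algebraMap R L))
    (b : Module.Basis ι K V) (A : AssocStructure K V) (μ : ι × ι × ι → R) {g : Matrix ι ι L}
    (hg : IsUnit g.det)
    (hrel : ∀ i j k, ∑ p, g p i * ∑ q, g q j * algebraMap R L (μ (p, q, k)) =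
      ∑ l, algebraMap K L (structureConstants b A.mul (i, j, l)) * g k l) :
    ∃ φ : AssocStructure R (ι → R), structureConstants (Pi.basisFun R ι) φ.mul = μ ∧
      (φ.baseChange L).IsIsomorphic (A.baseChange L) := by
  let m : (ι → R) →ₗ[R] (ι → R) →ₗ[R] (ι → R) := (Pi.basisFun R ι).constr R fun i =>
    (Pi.basisFun R ι).constr R fun j k => μ (i, j, k)
  have hm : structureConstants (Pi.basisFun R ι) m = μ := by
    ext x
    simp only [structureConstants, m, Module.Basis.constr_basis, Pi.basisFun_repr]
  let e := Algebra.TensorProduct.basis L (Pi.basisFun R ι)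
  let c := Algebra.TensorProduct.basis L b
  let h : L ⊗[K] V ≃ₗ[L] L ⊗[R] (ι → R) :=
    (Matrix.toLinearEquiv c g hg).trans (c.equiv e (Equiv.refl ι))
  have hc : ∀ i, h (c i) = ∑ p, g p i • e p := by
    intro i
    change c.equiv e (Equiv.refl ι) (Matrix.toLin c c g (c i)) = _
    rw [Matrix.toLin_self, map_sum]
    simp
  let mL := LinearMap.BilinMap.baseChange L m
  have hmL : ∀ p q k, e.repr (mL (e p) (e q)) k = algebraMap R L (μ (p, q, k)) := by
    intro p q k
    rw [← hm]
    exact structureConstants_baseChange (S := L) (Pi.basisFun R ι) m (p, q, k)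
  have hAL : ∀ i j, (A.baseChange L).mul (c i) (c j) =
      ∑ l, algebraMap K L (structureConstants b A.mul (i, j, l)) • c l := by
    intro i j
    rw [← c.sum_repr ((A.baseChange L).mul (c i) (c j))]
    refine Finset.sum_congr rfl fun l _ => ?_
    congr 1
    exact structureConstants_baseChange (S := L) b A.mul (i, j, l)
  have hmul : ∀ x y, h ((A.baseChange L).mul x y) = mL (h x) (h y) := by
    refine LinearEquiv.map_mul_of_basis c h fun i j => e.repr.injective ?_
    ext k
    rw [hAL, hc i, hc j, LinearMap.map_sum₂]
    simp only [map_sum, map_smul, hc, LinearMap.smul_apply, Finsupp.coe_finsetSum, Finset.sum_apply,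
      Finsupp.smul_apply, smul_eq_mul, hmL]
    have h1 : ∑ p, ∑ q, g q j * (g p i * algebraMap R L (μ (p, q, k))) =
        ∑ p, g p i * ∑ q, g q j * algebraMap R L (μ (p, q, k)) := by
      simp only [Finset.mul_sum]
      exact Finset.sum_congr rfl fun p _ => Finset.sum_congr rfl fun q _ => by ring
    rw [h1, hrel]
    refine Finset.sum_congr rfl fun l _ => ?_
    simp [Finsupp.single_apply]
  have hassoc : ∀ x y z, mL (mL x y) z = mL x (mL y z) := by
    intro x y z
    obtain ⟨x, rfl⟩ := h.surjective x
    obtain ⟨y, rfl⟩ := h.surjective y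
    obtain ⟨z, rfl⟩ := h.surjective z
    simp only [← hmul, (A.baseChange L).assoc]
  have htmul : Function.Injective fun x : ι → R => (1 : L) ⊗ₜ[R] x := by
    intro x y hxy
    ext i
    have := congrArg (fun z => e.repr z i) hxy
    simp only [e, Algebra.TensorProduct.basis_repr_tmul] at this
    exact hinj (by simpa using this)
  have hmL1 : ∀ x y, mL ((1 : L) ⊗ₜ[R] x) ((1 : L) ⊗ₜ[R] y) = (1 : L) ⊗ₜ[R] m x y := by
    intro x y
    simp [mL]
  let φ : AssocStructure R (ι → R) := ⟨m, fun x y z => htmul (by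
    have := hassoc ((1 : L) ⊗ₜ[R] x) ((1 : L) ⊗ₜ[R] y) ((1 : L) ⊗ₜ[R] z)
    simpa only [hmL1] using this)⟩
  refine ⟨φ, hm, h.symm, fun x y => ?_⟩
  rw [LinearEquiv.symm_apply_eq, hmul]
  simp only [LinearEquiv.apply_symm_apply]
  rfl

theorem LaurentSeries.algebraMap_eq_algebraMap_powerSeries {K : Type*} [CommRing K] (k : K) :
    algebraMap K K⸨X⸩ k = algebraMap K⟦X⟧ K⸨X⸩ (algebraMap K K⟦X⟧ k) :=
  rfl

-- From a deformation to a degeneration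

attribute [local instance] evalZeroAlgebra

/-- The basis of `V` is the reduction of a `K⟦X⟧`-basis of the deformation, so the constants of `B`
are constant terms of power series. These series satisfy the equations of the orbit of `A` over
`K⸨X⸩`, hence over `K⟦X⟧`. -/
theorem FormalDeformation.eval_structureConstants_eq_zero {K : Type u} {V : Type v} [Field K]
    [Infinite K] [AddCommGroup V] [Module K V] [FiniteDimensional K V] {A B : AssocStructure K V}
    (𝒳 : FormalDeformation.{u, v, w} B)
    (h𝒳 : (𝒳.alg.baseChange K⸨X⸩).IsIsomorphic (A.baseChange K⸨X⸩)) :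
    ∃ (ι : Type w) (_ : Finite ι) (b : Module.Basis ι K V), ∀ p : MvPolynomial (ι × ι × ι) K,
      (∀ ψ ∈ MulAction.orbit (V ≃ₗ[K] V) A,
        MvPolynomial.eval (structureConstants b ψ.mul) p = 0) →
      MvPolynomial.eval (structureConstants b B.mul) p = 0 := by
  have := 𝒳.torsionFree
  have := 𝒳.complete
  have : Module.Finite K (K ⊗[K⟦X⟧] 𝒳.carrier) := Module.Finite.equiv 𝒳.specialization.symm
  have : Module.Finite K⟦X⟧ 𝒳.carrier := PowerSeries.finite_of_isAdicComplete
  have : Module.Free K⟦X⟧ 𝒳.carrier := inferInstance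
  let e := Module.Free.chooseBasis K⟦X⟧ 𝒳.carrier
  let ι := Module.Free.ChooseBasisIndex K⟦X⟧ 𝒳.carrier
  let b : Module.Basis ι K V := (Algebra.TensorProduct.basis K e).map 𝒳.specialization
  classical
  refine ⟨ι, inferInstance, b, fun p hp => ?_⟩
  have hB : structureConstants b B.mul =
      fun x => PowerSeries.constantCoeff (structureConstants e 𝒳.alg.mul x) := by
    rw [structureConstants_map (Algebra.TensorProduct.basis K e) 𝒳.specialization
      (m := (𝒳.alg.baseChange K).mul) 𝒳.specialization_mul]
    ext x
    exact structureConstants_baseChange (S := K) e 𝒳.alg.mul x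
  obtain ⟨f, hf⟩ := h𝒳
  have hL := structureConstants_of_equiv (Algebra.TensorProduct.basis K⸨X⸩ b)
    (Algebra.TensorProduct.basis K⸨X⸩ e) (m := (A.baseChange K⸨X⸩).mul)
    (m' := (𝒳.alg.baseChange K⸨X⸩).mul) f.symm (fun x y => by
      rw [LinearEquiv.symm_apply_eq, hf]
      simp)
  have hL1 : structureConstants (Algebra.TensorProduct.basis K⸨X⸩ e)
      (𝒳.alg.baseChange K⸨X⸩).mul = fun x =>
        algebraMap K⟦X⟧ K⸨X⸩ (structureConstants e 𝒳.alg.mul x) :=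
    funext fun x => structureConstants_baseChange (S := K⸨X⸩) e 𝒳.alg.mul x
  have hL2 : structureConstants (Algebra.TensorProduct.basis K⸨X⸩ b)
      (A.baseChange K⸨X⸩).mul = fun x => algebraMap K K⸨X⸩ (structureConstants b A.mul x) :=
    funext fun x => structureConstants_baseChange (S := K⸨X⸩) b A.mul x
  rw [hL1, hL2] at hL
  have h0 := A.aeval_transportConstants_eq_zero b hp (S := K⸨X⸩)
    (g := LinearMap.toMatrix (Algebra.TensorProduct.basis K⸨X⸩ b)
      (Algebra.TensorProduct.basis K⸨X⸩ e) (f.symm : _ →ₗ[K⸨X⸩] _))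
    (g' := LinearMap.toMatrix (Algebra.TensorProduct.basis K⸨X⸩ e)
      (Algebra.TensorProduct.basis K⸨X⸩ b) (f.symm.symm : _ →ₗ[K⸨X⸩] _)) (by
      rw [← LinearMap.toMatrix_comp, LinearEquiv.symm_symm, LinearEquiv.comp_symm,
        LinearMap.toMatrix_id])
  rw [← hL] at h0
  have h1 : MvPolynomial.aeval (structureConstants e 𝒳.alg.mul) p = 0 := by
    apply IsFractionRing.injective K⟦X⟧ K⸨X⸩
    rw [map_zero, ← h0, MvPolynomial.aeval_def, MvPolynomial.aeval_def, MvPolynomial.hom_eval₂]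
    congr 1
  have h2 := congrArg (PowerSeries.constantCoeff (R := K)) h1
  rw [map_zero, MvPolynomial.aeval_def, MvPolynomial.hom_eval₂] at h2
  rw [hB, MvPolynomial.eval, MvPolynomial.coe_eval₂Hom, ← h2]
  congr 1

theorem FormalDeformation.isDegenerationOf {K : Type u} {V : Type v} [Field K]
    [Infinite K] [AddCommGroup V] [Module K V] [FiniteDimensional K V] {A B : AssocStructure K V}
    (𝒳 : FormalDeformation.{u, v, w} B)
    (h𝒳 : (𝒳.alg.baseChange K⸨X⸩).IsIsomorphic (A.baseChange K⸨X⸩)) : B.IsDegenerationOf A := by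
  obtain ⟨ι, _, b, hb⟩ := 𝒳.eval_structureConstants_eq_zero h𝒳
  rintro _ ⟨g, rfl⟩
  have hg : ∀ φ : AssocStructure K V,
      structureConstants (b.map g) (g • φ).mul = structureConstants b φ.mul := fun φ =>
    structureConstants_map b g fun x y => by simp
  -- In the basis moved by `g`, the algebra `g • B` has the constants of `B` in `b`, and the orbit
  -- of `A` is stable under `g`.
  rw [AssocStructure.mem_closure_iff_forall_mvPolynomial (b.map g)]
  intro p hp
  rw [show (fun m : V ≃ₗ[K] V => m • B) g = g • B from rfl, hg]
  refine hb p fun ψ hψ => ?_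
  rw [← hg]
  refine hp _ ?_
  obtain ⟨g', rfl⟩ := hψ
  exact ⟨g * g', mul_smul g g' A⟩

/-! ### From a degeneration to a deformation -/

/-- The coordinates of a formal arc in the orbit closure which specializes to a given point. -/
theorem AssocStructure.exists_powerSeries_constants {K ι V : Type*} [Field K] [IsAlgClosed K]
    [Fintype ι] [DecidableEq ι] [AddCommGroup V] [Module K V] (b : Module.Basis ι K V)
    (F : Type*) [Field F] [Algebra (MvPolynomial (Option (ι × ι)) K) F]
    [IsFractionRing (MvPolynomial (Option (ι × ι)) K) F] [Algebra K F]
    [IsScalarTower K (MvPolynomial (Option (ι × ι)) K) F]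
    {A B : AssocStructure K V} (hB : B ∈ closure (MulAction.orbit (V ≃ₗ[K] V) A)) :
    ∃ (μ : ι × ι × ι → K⟦X⟧) (y : Matrix ι ι K⟦X⟧) (w : K⟦X⟧), w ≠ 0 ∧ y.det ≠ 0 ∧
      (∀ x, PowerSeries.constantCoeff (μ x) = structureConstants b B.mul x) ∧
      ∀ i j k, ∑ p, y p i * ∑ q, y q j * μ (p, q, k) =
        w * ∑ l, algebraMap K K⟦X⟧ (structureConstants b A.mul (i, j, l)) * y k l := by
  set a := structureConstants b A.mul
  set f := algebraMap (MvPolynomial (Option (ι × ι)) K) F with hf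
  have hPF : Function.Injective f := IsFractionRing.injective _ _
  have hKF : ∀ k, f (algebraMap K _ k) = algebraMap K F k := fun k =>
    (IsScalarTower.algebraMap_apply K _ F k).symm
  let t : F := f (MvPolynomial.X none)
  let G : Matrix ι ι F := (genericMatrix ι K).map (f)
  have ht : t ≠ 0 := by
    rw [Ne, map_eq_zero_iff _ hPF]
    exact MvPolynomial.X_ne_zero _
  have hGdet : G.det = f (genericMatrix ι K).det :=
    (RingHom.map_det (f) _).symm
  have hG : G.det ≠ 0 := by
    rw [hGdet, Ne, map_eq_zero_iff _ hPF]
    exact det_genericMatrix_ne_zero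
  let c : ι × ι × ι → F := fun x => f (genericConstants a x)
  have hc : ∀ x, c x = t * transportConstants (fun y => algebraMap K F (a y)) G G.adjugate x := by
    intro x
    have hadj : (genericMatrix ι K).adjugate.map (f) = G.adjugate :=
      RingHom.map_adjugate (f) _
    simp only [c, genericConstants, map_mul]
    rw [map_transportConstants, hadj]
    simp only [hKF]
    rfl
  -- With this `s`, the matrix `s⁻¹ • G` is multiplicative from the constants `a` to the constants
  -- `c`.
  set s : F := t * G.det ^ 2 with hs
  have hs0 : s ≠ 0 := mul_ne_zero ht (pow_ne_zero _ hG)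
  have hrel : ∀ i j k, ∑ p, G p i * ∑ q, G q j * c (p, q, k) =
      s * ∑ l, algebraMap K F (a (i, j, l)) * G k l := by
    intro i j k
    have := sum_mul_transportConstants (fun y => algebraMap K F (a y)) (g := G)
      (Matrix.adjugate_mul G) i j k
    simp only [hc]
    rw [hs, mul_assoc, ← this]
    simp only [Finset.mul_sum]
    exact Finset.sum_congr rfl fun p _ => Finset.sum_congr rfl fun q _ => by ring
  obtain ⟨T, z, M, hcT, hT, hz, hzT, hgT, hM, hcM⟩ := exists_finiteType_subalgebra_isMaximal c
    (structureConstants b B.mul) (fun x : ι × ι => s⁻¹ * G x.1 x.2) (by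
      intro p hp
      refine (AssocStructure.mem_closure_iff_forall_mvPolynomial b).1 hB p ?_
      rintro _ ⟨g, rfl⟩
      have h1 : MvPolynomial.aeval (genericConstants a) p = 0 := by
        apply hPF
        rw [map_zero, ← hp]
        exact (MvPolynomial.aeval_algebraMap_apply F _ p).symm
      have hinv : LinearMap.toMatrix b b (g.symm : V →ₗ[K] V) *
          LinearMap.toMatrix b b (g : V →ₗ[K] V) = 1 := by
        rw [← LinearMap.toMatrix_comp, LinearEquiv.symm_comp, LinearMap.toMatrix_id]
      set H := LinearMap.toMatrix b b (g : V →ₗ[K] V)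
      set H' := LinearMap.toMatrix b b (g.symm : V →ₗ[K] V)
      have hdet : H'.det * H.det = 1 := by rw [← Matrix.det_mul, hinv, Matrix.det_one]
      let v : Option (ι × ι) → K := fun o => o.elim (H'.det ^ 2) fun x => H x.1 x.2
      have hv : pointMatrix v = H := rfl
      have h2 := congrArg (MvPolynomial.aeval v) h1
      rw [MvPolynomial.comp_aeval_apply, map_zero] at h2
      rw [← MvPolynomial.coe_aeval_eq_eval, ← h2]
      change MvPolynomial.aeval (structureConstants b (g • A).mul) p = _
      congr 2
      rw [structureConstants_of_equiv b b g (m := A.mul) (m' := (g • A).mul) (fun x y => by simp)]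
      ext x
      rw [aeval_genericConstants, hv, transportConstants_adjugate _ hinv, ← mul_assoc]
      change _ = H'.det ^ 2 * H.det ^ 2 * _
      rw [← mul_pow, hdet, one_pow, one_mul]
      rfl)
  have : Algebra.FiniteType K T := (Subalgebra.fg_iff_finiteType T).1 hT
  -- Homogeneous coordinates of `s⁻¹ • G` on the chart: the matrix is `yT` divided by `wT`, and
  -- multiplicativity, cleared of denominators, is a relation in `T` that any arc preserves.
  let yT : Matrix ι ι T := Matrix.of fun i j => ⟨z⁻¹ * (s⁻¹ * G i j), hgT (i, j)⟩
  let wT : T := ⟨z⁻¹, hzT⟩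
  let cT : ι × ι × ι → T := fun x => ⟨c x, hcT x⟩
  have hyT : yT.map (algebraMap T F) = (z⁻¹ * s⁻¹) • G := by
    ext i j
    change z⁻¹ * (s⁻¹ * G i j) = (z⁻¹ * s⁻¹) * G i j
    ring
  have hne : wT * yT.det ≠ 0 := by
    have h1 : wT ≠ 0 := fun h => inv_ne_zero hz (congrArg Subtype.val h)
    refine mul_ne_zero h1 fun h => ?_
    have h2 : (yT.map (algebraMap T F)).det = 0 := by
      rw [← RingHom.mapMatrix_apply, ← RingHom.map_det, h, map_zero]
    rw [hyT, Matrix.det_smul] at h2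
    exact mul_ne_zero (pow_ne_zero _ (mul_ne_zero (inv_ne_zero hz) (inv_ne_zero hs0))) hG h2
  have hrelT : ∀ i j k, ∑ p, yT p i * ∑ q, yT q j * cT (p, q, k) =
      wT * ∑ l, algebraMap K T (a (i, j, l)) * yT k l := by
    intro i j k
    have hTF : Function.Injective (algebraMap T F) := Subtype.val_injective
    apply hTF
    simp only [map_sum, map_mul]
    change ∑ p, (z⁻¹ * (s⁻¹ * G p i)) * ∑ q, (z⁻¹ * (s⁻¹ * G q j)) * c (p, q, k) =
      z⁻¹ * ∑ l, algebraMap K F (a (i, j, l)) * (z⁻¹ * (s⁻¹ * G k l))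
    have h1 : ∑ p, (z⁻¹ * (s⁻¹ * G p i)) * ∑ q, (z⁻¹ * (s⁻¹ * G q j)) * c (p, q, k) =
        (z⁻¹ * s⁻¹) ^ 2 * ∑ p, G p i * ∑ q, G q j * c (p, q, k) := by
      simp only [Finset.mul_sum]
      exact Finset.sum_congr rfl fun p _ => Finset.sum_congr rfl fun q _ => by ring
    rw [h1, hrel]
    simp only [Finset.mul_sum]
    refine Finset.sum_congr rfl fun l _ => ?_
    field_simp
  obtain ⟨θ, hθ, hθM⟩ := M.exists_algHom_powerSeries (K := K) hne
  rw [map_mul] at hθ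
  refine ⟨fun x => θ (cT x), yT.map θ, θ wT, left_ne_zero_of_mul hθ, ?_, fun x => ?_,
    fun i j k => ?_⟩
  · have := right_ne_zero_of_mul hθ
    rwa [AlgHom.map_det, AlgHom.mapMatrix_apply] at this
  · have := hθM _ (hcM x)
    rw [map_sub, map_sub, AlgHom.commutes, sub_eq_zero] at this
    exact this.trans (by simp)
  · have := congrArg θ (hrelT i j k)
    simpa only [map_sum, map_mul, AlgHom.commutes, Matrix.map_apply] using this

theorem AssocStructure.IsDegenerationOf.exists_formalDeformation {K : Type u} {V : Type v} [Field K]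
    [IsAlgClosed K] [AddCommGroup V] [Module K V] [FiniteDimensional K V]
    {A B : AssocStructure K V} (h : B.IsDegenerationOf A) :
    ∃ 𝒳 : FormalDeformation.{u, v, max u v} B,
      (𝒳.alg.baseChange K⸨X⸩).IsIsomorphic (A.baseChange K⸨X⸩) := by
  classical
  let ι := Module.Free.ChooseBasisIndex K V
  let b : Module.Basis ι K V := Module.Free.chooseBasis K V
  obtain ⟨μ, y, w, hw, hy, hμ, hrel⟩ := AssocStructure.exists_powerSeries_constants b
    (FractionRing (MvPolynomial (Option (ι × ι)) K)) (h ⟨1, one_smul _ B⟩)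
  have hinj : Function.Injective (algebraMap K⟦X⟧ K⸨X⸩) := IsFractionRing.injective K⟦X⟧ K⸨X⸩
  set f := algebraMap K⟦X⟧ K⸨X⸩ with hf
  have hw' : f w ≠ 0 := by rwa [Ne, map_eq_zero_iff _ hinj]
  -- Over `K⸨X⸩` the nonzero `w` can be divided out, which turns the homogeneous relation into
  -- multiplicativity of `w⁻¹ • y`.
  obtain ⟨φ, hφ, hiso⟩ := AssocStructure.exists_isIsomorphic_baseChange hinj b A μ
    (g := (f w)⁻¹ • y.map f) (by
      rw [Matrix.det_smul, isUnit_iff_ne_zero]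
      refine mul_ne_zero (pow_ne_zero _ (inv_ne_zero hw')) ?_
      rw [← RingHom.mapMatrix_apply, ← RingHom.map_det, Ne, map_eq_zero_iff _ hinj]
      exact hy) (by
      intro i j k
      have h1 := congrArg f (hrel i j k)
      simp only [map_sum, map_mul, hf, ← LaurentSeries.algebraMap_eq_algebraMap_powerSeries] at h1
      rw [← hf] at h1
      have h2 : ∑ p, ((f w)⁻¹ • y.map f) p i * ∑ q, ((f w)⁻¹ • y.map f) q j * f (μ (p, q, k)) =
          (f w)⁻¹ ^ 2 * ∑ p, f (y p i) * ∑ q, f (y q j) * f (μ (p, q, k)) := by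
        simp only [Finset.mul_sum]
        refine Finset.sum_congr rfl fun p _ => Finset.sum_congr rfl fun q _ => ?_
        simp only [Matrix.smul_apply, Matrix.map_apply, smul_eq_mul]
        ring
      rw [h2, h1]
      simp only [Finset.mul_sum]
      refine Finset.sum_congr rfl fun l _ => ?_
      simp only [Matrix.smul_apply, Matrix.map_apply, smul_eq_mul]
      field_simp)
  have hsc : structureConstants (Algebra.TensorProduct.basis K (Pi.basisFun K⟦X⟧ ι))
      (φ.baseChange K).mul = structureConstants b B.mul := by
    ext x
    rw [← hμ, ← hφ]
    exact structureConstants_baseChange (S := K) (Pi.basisFun K⟦X⟧ ι) φ.mul x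
  exact ⟨{ carrier := ι → K⟦X⟧
           alg := φ
           torsionFree := inferInstance
           complete := PowerSeries.isAdicComplete_pi K ι
           specialization := (Algebra.TensorProduct.basis K (Pi.basisFun K⟦X⟧ ι)).equiv b
            (Equiv.refl ι)
           specialization_mul := LinearEquiv.map_mul_of_structureConstants_eq _ b hsc }, hiso⟩

theorem theorem4p1 {K : Type u} {V : Type v} [Field K] [IsAlgClosed K] [AddCommGroup V]
    [Module K V] [FiniteDimensional K V] (A B : AssocStructure K V) :
    B.IsDegenerationOf A ↔
      ∃ 𝒳 : FormalDeformation.{u, v, max u v} B,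
        (𝒳.alg.baseChange K⸨X⸩).IsIsomorphic (A.baseChange K⸨X⸩) := by
  exact ⟨fun h => h.exists_formalDeformation, fun ⟨𝒳, h𝒳⟩ => 𝒳.isDegenerationOf h𝒳⟩
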